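/- **Setting.** Fix integers $K\ge 1$, $K_z\ge 0$ and put $K_{vz}=K+K_z$. For all $N,T$, the $N\times1$ vector of gross returns in period $t$ is $$r_t=c+\beta f_t+u_t,\qquad f_t=d_g(g_t-\mu_g)+v_t,\qquad u_t=\gamma z_t+e_t,\qquad c=\iota_N\lambda_0+\beta\lambda_f,$$ with observed proxy factors $g_t\in\mathbb R^K$, $\mu_g=\mathbb E g_t$, omitted factors $v_t\in\mathbb R^{K}$, $z_t\in\mathbb R^{K_z}$, and noise $e_t\in\mathbb R^N$ with finite second moments; $\iota_N$ is the vector of ones. The process $(g_t)$ does not depend on $(N,T)$; all other objects may, and the loadings $\beta,\gamma$ may be random. Write $u_{vz,t}=(v_t',z_t')'$, $c_{\beta\gamma}=(\beta,\gamma)$ with rows $c_{\beta\gamma,i}$, and $\gamma_N(t,t')=\mathbb E\big(N^{-1}\sum_{i=1}^N e_{it}e_{it'}\big)$. Limits, $o_p$ and $O_p$ are for $N,T\to\infty$ jointly. Assume, for some constant $L<\infty$ and all $N,T$, and all periods $t,t',s\le T$: 1. $(g_t)$, $(v_t)$, $(u_t)$ are strictly stationary with finite fourth moments; $\mathbb E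 f_t=0$; $g_t$ is uncorrelated with $u_t$ and $v_t$; the $K\times K$ matrix $d_g$ has full rank; $\lambda_0\ne0$, and $(\lambda_0,\lambda_f)$ stays in a compact set. 2. $\|c_{\beta\gamma,i}\|\le L$ almost surely for all $i$, and $N^{-1}c_{\beta\gamma}'c_{\beta\gamma}-Q=o_p(1)$ for some positive definite matrix $Q$. 3. $T^{-1}\sum_{t,t'\le T}|\gamma_N(t,t')|\le L$, $|\gamma_N(t,t')|\le L$, and $T^{-2}\sum_{t,t'\le T}\mathbb E\big(\sum_i e_{it}e_{it'}-\mathbb E\sum_i e_{it}e_{it'}\big)^2\le LN$. 4. $\mathbb E\big|N^{-1/2}\sum_{i}(e_{it}e_{is}-\mathbb E e_{it}e_{is})\big|^4\le L$. 5. $\mathbb E\frac1N\sum_{i}\big\|T^{-1/2}\sum_{t\le T}g_te_{it}\big\|^2\le L$, $\ \mathbb E\frac1{K_{vz}}\sum_{a\le K_{vz}}\big\|T^{-1/2}\sum_{t\le T}g_tu_{vz,at}\big\|^2\le L$, $\ \mathbb E\frac1N\sum_{i}\big\|T^{-1/2}\sum_{t\le T}u_{vz,t}e_{it}\big\|^2\le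 L$. 6. $\mathbb E\sum_{t\le T}\big(\sum_i c_{\beta\gamma,ia}e_{it}\big)^2\le LNT$ and $\mathbb E\big(\sum_{t\le T}\sum_i c_{\beta\gamma,ia}e_{it}\big)^2\le LNT$ for each $a\le K_{vz}$. 7. $\big\|T^{-1}\sum_{t\le T}u_{vz,t}u_{vz,t}'-\Sigma_{vz}\big\|_{\max}=O_p(T^{-1/2})$ for some positive definite matrix $\Sigma_{vz}$. 8. $T^{-1}\sum_{t\le T}u_{vz,t}=o_p(1)$. Let $\widehat u_g$ be the $T\times N$ matrix whose $i$-th column is the residual vector of the OLS regression of $(r_{it})_{t\le T}$ on a constant and $\bar g_t=g_t-T^{-1}\sum_{s\le T}g_s$. Let $\lambda_j(A)$ be the $j$-th largest eigenvalue of a symmetric $T\times T$ matrix $A$ (set to $0$ if $j>T$), let $K_{vz,\max}>K_{vz}$ be a fixed integer, and let $\phi(N,T)$ satisfy $$\phi(N,T)\to0,\qquad \frac{\phi(N,T)}{N^{-1/2}+T^{-1/2}}\to\infty .$$ **Theorem.** Let $$\widehat K_{vz}\in\operatorname*{arg\,min}_{K\le j\le K_{vz,\max}}\Big(N^{-1}T^{-1}\lambda_j(\widehat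 u_g\widehat u_g')+j\,\phi(N,T)\Big)-1,$$ with ties broken in any way. Then $\widehat K_{vz}\to_p K_{vz}$ as $N,T\to\infty$. -/

import Mathlib

open MeasureTheory ProbabilityTheory Filter Topology
open scoped ENNReal

noncomputable section

namespace OmittedFactors

/-- The primitives of the model, for panels with `N` assets and `T` periods.  Time runs over `ℕ`,
and the sample of length `T` consists of the periods `t < T`.  The observed proxy factors `g` form
one fixed process; all other objects may change with `(N, T)`.  The loadings may be random. -/
structure FactorModel (Ω : Type*) (K Kz : ℕ) where
  /-- observed proxy factors `g_t` -/
  g : ℕ → Ω → Fin K → ℝ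
  /-- the `K × K` matrix `d_g` linking the priced factors with their proxies -/
  dg : ℕ → ℕ → Matrix (Fin K) (Fin K) ℝ
  /-- omitted part `v_t` of the priced factors -/
  v : ℕ → ℕ → ℕ → Ω → Fin K → ℝ
  /-- further omitted strong factors `z_t` -/
  z : ℕ → ℕ → ℕ → Ω → Fin Kz → ℝ
  /-- idiosyncratic noise `e_t` -/
  e : (N : ℕ) → ℕ → ℕ → Ω → Fin N → ℝ
  /-- loadings `β` of the priced factors -/
  β : (N : ℕ) → ℕ → Ω → Matrix (Fin N) (Fin K) ℝ
  /-- loadings `γ` of the factors `z_t` -/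
  γ : (N : ℕ) → ℕ → Ω → Matrix (Fin N) (Fin Kz) ℝ
  /-- zero-beta return `λ₀` -/
  lam0 : ℕ → ℕ → ℝ
  /-- risk premia `λ_f` -/
  lamf : ℕ → ℕ → Fin K → ℝ

/-- The `j`-th largest eigenvalue (`j = 1, …, T`, with multiplicity) of a symmetric `T × T` matrix;
`0` for `j` outside of this range. -/
def eigDesc {T : ℕ} {A : Matrix (Fin T) (Fin T) ℝ} (hA : A.IsHermitian) (j : ℕ) : ℝ :=
  if h : 1 ≤ j ∧ j ≤ T then
    hA.eigenvalues₀ ⟨j - 1, by rw [Fintype.card_fin]; omega⟩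
  else 0

/-- Strict stationarity: all time shifts of the process have the same law on path space. -/
def Stationary {Ω E : Type*} [MeasurableSpace Ω] [MeasurableSpace E] (μ : Measure Ω)
    (X : ℕ → Ω → E) : Prop :=
  ∀ h : ℕ, IdentDistrib (fun ω t => X (t + h) ω) (fun ω t => X t ω) μ μ

/-- `X_{N,T} = o_p(1)` as `N, T → ∞`. -/
def IsLittleOp {Ω : Type*} [MeasurableSpace Ω] (μ : Measure Ω) (X : ℕ → ℕ → Ω → ℝ) : Prop :=
  TendstoInMeasure μ (fun p : ℕ × ℕ => X p.1 p.2) (atTop ×ˢ atTop) (fun _ => 0)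

/-- `X_{N,T} = O_p(a_{N,T})` as `N, T → ∞`. -/
def IsBigOp {Ω : Type*} [MeasurableSpace Ω] (μ : Measure Ω) (X : ℕ → ℕ → Ω → ℝ)
    (a : ℕ → ℕ → ℝ) : Prop :=
  ∀ ε : ℝ≥0∞, 0 < ε → ∃ C : ℝ, ∀ᶠ p : ℕ × ℕ in atTop ×ˢ atTop,
    μ {ω | C * a p.1 p.2 < |X p.1 p.2 ω|} ≤ ε

/-- Expectation of a nonnegative random variable, with the value `∞` if it is not integrable. -/
def nnExp {Ω : Type*} [MeasurableSpace Ω] (μ : Measure Ω) (X : Ω → ℝ) : ℝ≥0∞ :=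
  ∫⁻ ω, ENNReal.ofReal (X ω) ∂μ

namespace FactorModel

variable {Ω : Type*} {K Kz : ℕ} (M : FactorModel Ω K Kz)

/-- The omitted strong factors `u_{vz,t} = (v_t, z_t)`. -/
def uvz (N T t : ℕ) (ω : Ω) : Fin K ⊕ Fin Kz → ℝ :=
  Sum.elim (M.v N T t ω) (M.z N T t ω)

/-- Their loadings `c_{βγ} = (β, γ)`. -/
def cβγ (N T : ℕ) (ω : Ω) : Matrix (Fin N) (Fin K ⊕ Fin Kz) ℝ :=
  Matrix.fromCols (M.β N T ω) (M.γ N T ω)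

/-- The error term `u_t = γ z_t + e_t`. -/
def u (N T t : ℕ) (ω : Ω) : Fin N → ℝ :=
  (M.γ N T ω).mulVec (M.z N T t ω) + M.e N T t ω

/-- The mean `μ_g` of the proxy factors. -/
def μg [MeasurableSpace Ω] (μ : Measure Ω) (k : Fin K) : ℝ := ∫ ω, M.g 0 ω k ∂μ

/-- The priced factors `f_t = d_g (g_t - μ_g) + v_t`. -/
def f [MeasurableSpace Ω] (μ : Measure Ω) (N T t : ℕ) (ω : Ω) : Fin K → ℝ :=
  (M.dg N T).mulVec (M.g t ω - M.μg μ) + M.v N T t ω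

/-- The intercept `c = ι λ₀ + β λ_f`. -/
def c (N T : ℕ) (ω : Ω) : Fin N → ℝ :=
  (fun _ => M.lam0 N T) + (M.β N T ω).mulVec (M.lamf N T)

/-- The gross returns `r_t = c + β f_t + u_t`. -/
def r [MeasurableSpace Ω] (μ : Measure Ω) (N T t : ℕ) (ω : Ω) : Fin N → ℝ :=
  M.c N T ω + (M.β N T ω).mulVec (M.f μ N T t ω) + M.u N T t ω

/-- The demeaned proxies `ḡ_t = g_t - T⁻¹ ∑_{s<T} g_s`. -/
def gbar (T t : ℕ) (ω : Ω) (k : Fin K) : ℝ :=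
  M.g t ω k - (T : ℝ)⁻¹ * ∑ s ∈ Finset.range T, M.g s ω k

/-- The span in `ℝ^T` of the regressors: the constant and the `K` demeaned proxies. -/
def regressorSpan (T : ℕ) (ω : Ω) : Submodule ℝ (EuclideanSpace ℝ (Fin T)) :=
  Submodule.span ℝ
    (insert (WithLp.toLp 2 fun _ => 1)
      (Set.range fun k : Fin K => WithLp.toLp 2 fun t : Fin T => M.gbar T t ω k))

/-- The `T × N` matrix `û_g` of first-pass OLS residuals `r_t - ĉ - β̂_g ḡ_t`.  For each asset, the
residual vector of the least-squares regression is the return series minus its orthogonal projection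
on the span of the regressors (also where the regressors are collinear). -/
def uhat [MeasurableSpace Ω] (μ : Measure Ω) (N T : ℕ) (ω : Ω) : Matrix (Fin T) (Fin N) ℝ :=
  Matrix.of fun t i =>
    (WithLp.toLp 2 (fun s : Fin T => M.r μ N T s ω i) -
      (M.regressorSpan T ω).starProjection
        (WithLp.toLp 2 fun s : Fin T => M.r μ N T s ω i)) t

theorem uhat_isHermitian [MeasurableSpace Ω] (μ : Measure Ω) (N T : ℕ) (ω : Ω) :
    (M.uhat μ N T ω * (M.uhat μ N T ω).transpose).IsHermitian := by
  simpa [Matrix.conjTranspose_eq_transpose_of_trivial] using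
    Matrix.isHermitian_mul_conjTranspose_self (M.uhat μ N T ω)

/-- The penalized eigenvalue criterion `N⁻¹ T⁻¹ λ_j(û_g û_g') + j φ(N,T)`. -/
def criterion [MeasurableSpace Ω] (μ : Measure Ω) (φ : ℕ → ℕ → ℝ) (N T : ℕ) (ω : Ω) (j : ℕ) : ℝ :=
  (N : ℝ)⁻¹ * (T : ℝ)⁻¹ * eigDesc (M.uhat_isHermitian μ N T ω) j + j * φ N T

/-- `k` is a value of `argmin_{K ≤ j ≤ Kmax} (criterion at j) - 1`, ties broken in any way. -/
def IsFactorNumberEstimate [MeasurableSpace Ω] (μ : Measure Ω) (φ : ℕ → ℕ → ℝ) (Kmax : ℕ)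
    (N T : ℕ) (ω : Ω) (k : ℕ) : Prop :=
  k + 1 ∈ Finset.Icc K Kmax ∧
    ∀ j ∈ Finset.Icc K Kmax, M.criterion μ φ N T ω (k + 1) ≤ M.criterion μ φ N T ω j

/-- `γ_N(t,t') = E(N⁻¹ ∑_i e_{it} e_{it'})`. -/
def γN [MeasurableSpace Ω] (μ : Measure Ω) (N T t t' : ℕ) : ℝ :=
  ∫ ω, (N : ℝ)⁻¹ * ∑ i, M.e N T t ω i * M.e N T t' ω i ∂μ

variable [MeasurableSpace Ω] (μ : Measure Ω)

/-- The random inputs are random variables, and the noise has second moments. -/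
structure WellPosed : Prop where
  z_meas : ∀ N T t, AEMeasurable (M.z N T t) μ
  e_memLp : ∀ N T t i, MemLp (fun ω => M.e N T t ω i) 2 μ
  β_meas : ∀ N T i k, AEMeasurable (fun ω => M.β N T ω i k) μ
  γ_meas : ∀ N T i k, AEMeasurable (fun ω => M.γ N T ω i k) μ

/-- The baseline factor model for the returns. -/
structure Baseline : Prop where
  g_memLp : ∀ t k, MemLp (fun ω => M.g t ω k) 4 μ
  v_memLp : ∀ N T t k, MemLp (fun ω => M.v N T t ω k) 4 μ
  u_memLp : ∀ N T t i, MemLp (fun ω => M.u N T t ω i) 4 μ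
  g_stationary : Stationary μ M.g
  v_stationary : ∀ N T, Stationary μ (M.v N T)
  u_stationary : ∀ N T, Stationary μ (M.u N T)
  f_mean : ∀ N T t k, ∫ ω, M.f μ N T t ω k ∂μ = 0
  cov_g_v : ∀ N T t k l, cov[fun ω => M.g t ω k, fun ω => M.v N T t ω l; μ] = 0
  cov_g_u : ∀ N T t k i, cov[fun ω => M.g t ω k, fun ω => M.u N T t ω i; μ] = 0
  dg_rank : ∀ N T, (M.dg N T).rank = K
  lam0_ne : ∀ N T, M.lam0 N T ≠ 0
  lam_compact : ∃ Θ : Set (ℝ × (Fin K → ℝ)), IsCompact Θ ∧ ∀ N T, (M.lam0 N T, M.lamf N T) ∈ Θ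

/-- Bounded loadings, with `N⁻¹ c_{βγ}' c_{βγ}` tending in probability to a positive definite
matrix. -/
def StrongLoadings : Prop :=
  (∃ L : ℝ, ∀ N T, ∀ᵐ ω ∂μ, ∀ i, ‖WithLp.toLp 2 (M.cβγ N T ω i)‖ ≤ L) ∧
  ∃ Q : Matrix (Fin K ⊕ Fin Kz) (Fin K ⊕ Fin Kz) ℝ, Q.PosDef ∧
    ∀ a b, IsLittleOp μ fun N T ω =>
      (N : ℝ)⁻¹ * ((M.cβγ N T ω).transpose * M.cβγ N T ω) a b - Q a b

/-- Weak serial and cross-sectional dependence of the noise. -/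
def WeakNoise : Prop :=
  ∃ L : ℝ, ∀ N T : ℕ,
    (T : ℝ)⁻¹ * ∑ t ∈ Finset.range T, ∑ t' ∈ Finset.range T, |M.γN μ N T t t'| ≤ L ∧
    (∀ t < T, ∀ t' < T, |M.γN μ N T t t'| ≤ L) ∧
    ENNReal.ofReal (((T : ℝ) ^ 2)⁻¹) * ∑ t ∈ Finset.range T, ∑ t' ∈ Finset.range T,
      nnExp μ (fun ω => (∑ i, M.e N T t ω i * M.e N T t' ω i
        - ∫ ω', ∑ i, M.e N T t ω' i * M.e N T t' ω' i ∂μ) ^ 2) ≤ ENNReal.ofReal (L * N)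

/-- Fourth moments of the normalized centred cross products of the noise. -/
def NoiseFourthMoments : Prop :=
  ∃ L : ℝ, ∀ N T : ℕ, ∀ t < T, ∀ s < T,
    nnExp μ (fun ω => |(√(N : ℝ))⁻¹ * ∑ i, (M.e N T t ω i * M.e N T s ω i
      - ∫ ω', M.e N T t ω' i * M.e N T s ω' i ∂μ)| ^ 4) ≤ ENNReal.ofReal L

/-- Weak dependence between the proxies, the omitted factors and the noise. -/
def WeakDependence : Prop :=
  ∃ L : ℝ, ∀ N T : ℕ,
    nnExp μ (fun ω => (N : ℝ)⁻¹ * ∑ i, ∑ k,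
      ((√(T : ℝ))⁻¹ * ∑ t ∈ Finset.range T, M.g t ω k * M.e N T t ω i) ^ 2) ≤ ENNReal.ofReal L ∧
    nnExp μ (fun ω => ((K + Kz : ℕ) : ℝ)⁻¹ * ∑ a, ∑ k,
      ((√(T : ℝ))⁻¹ * ∑ t ∈ Finset.range T, M.g t ω k * M.uvz N T t ω a) ^ 2) ≤ ENNReal.ofReal L ∧
    nnExp μ (fun ω => (N : ℝ)⁻¹ * ∑ i, ∑ a,
      ((√(T : ℝ))⁻¹ * ∑ t ∈ Finset.range T, M.uvz N T t ω a * M.e N T t ω i) ^ 2)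
        ≤ ENNReal.ofReal L

/-- Moment bounds for the noise weighted by the loadings. -/
def LoadingsNoise : Prop :=
  ∃ L : ℝ, ∀ N T : ℕ, ∀ a,
    nnExp μ (fun ω => ∑ t ∈ Finset.range T, (∑ i, M.cβγ N T ω i a * M.e N T t ω i) ^ 2)
      ≤ ENNReal.ofReal (L * N * T) ∧
    nnExp μ (fun ω => (∑ t ∈ Finset.range T, ∑ i, M.cβγ N T ω i a * M.e N T t ω i) ^ 2)
      ≤ ENNReal.ofReal (L * N * T)

/-- The second-moment matrix of the omitted factors is within `O_p(T^{-1/2})`, entry by entry, of a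
positive definite matrix. -/
def OmittedFactorMoments : Prop :=
  ∃ S : Matrix (Fin K ⊕ Fin Kz) (Fin K ⊕ Fin Kz) ℝ, S.PosDef ∧
    ∀ a b, IsBigOp μ (fun N T ω =>
      (T : ℝ)⁻¹ * ∑ t ∈ Finset.range T, M.uvz N T t ω a * M.uvz N T t ω b - S a b)
      (fun _ T => (√(T : ℝ))⁻¹)

/-- The sample means of the omitted factors vanish in probability. -/
def OmittedFactorMeans : Prop :=
  ∀ a, IsLittleOp μ fun N T ω => (T : ℝ)⁻¹ * ∑ t ∈ Finset.range T, M.uvz N T t ω a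

end FactorModel

end OmittedFactors

end

/-! Returns are an element of the span of the regressors plus omitted factors times loadings plus
noise, so the residuals are the omitted factors and the noise with the regressors projected out
(`uhat_col`). Write `m = K + Kz`. On the orthogonal complement of the `m` projected factors only
noise is left, so the eigenvalue of index `m + 1` is at most the noise level
(`eigDesc_residual_le`). On the span of these factors the quadratic form is of order `N T`, so the
`m`-th eigenvalue is too (`le_eigDesc_residual`).

After division by `N T` the noise level is of order `N^{-1/2} + T^{-1/2}`: the operator norm is
bounded by the Frobenius norm, whose expected square is controlled by `WeakNoise`. Hence it
eventually lies below `φ/2`. Stopping at an index `j ≤ m` costs a constant, which beats all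
penalties since `φ → 0`; an index beyond `m + 1` costs at least one more `φ`, which exceeds the
noise. The minimizer is `m + 1`, whence the `- 1` in the estimator.

The delicate point is that the regressors must not absorb the omitted factors. Their cross moments
with the factors are `o_p(T)`, but this bounds the projection only if the Gram matrix of the
regressors is of order `T` from below on their span. No ergodicity or nonsingularity is available
for this. Stationarity suffices: along each path a finite initial stretch already has a
nondegenerate Gram form on the span of the path, and by shift invariance most windows of a fixed
length are equally good (`exists_gram_lower_bound`). -/

/-! ### Min-max bounds for eigenvalues of a symmetric operator. -/

section CourantFischer

variable {E : Type*} [NormedAddCommGroup E] [InnerProductSpace ℝ E] [FiniteDimensional ℝ E]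
  {A : E →ₗ[ℝ] E} {n : ℕ}

/-- A subspace contains a nonzero vector whose coordinates vanish on a given index set, if that set
has fewer elements than the dimension of the subspace. -/
theorem OrthonormalBasis.exists_mem_ne_zero_repr_eq_zero (b : OrthonormalBasis (Fin n) ℝ E)
    (W : Submodule ℝ E) (s : Finset (Fin n)) (hs : s.card < Module.finrank ℝ W) :
    ∃ x ∈ W, x ≠ 0 ∧ ∀ j ∈ s, b.repr x j = 0 := by
  let F : W →ₗ[ℝ] (s → ℝ) :=
    LinearMap.pi fun j => (innerₛₗ ℝ (b j)).comp W.subtype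
  have hker : LinearMap.ker F ≠ ⊥ := by
    apply LinearMap.ker_ne_bot_of_finrank_lt
    simpa using hs
  obtain ⟨x, hx, hx0⟩ := Submodule.exists_mem_ne_zero_of_ne_bot hker
  refine ⟨x, x.2, by simpa using hx0, fun j hj => ?_⟩
  have := congrFun (LinearMap.mem_ker.1 hx) ⟨j, hj⟩
  simpa [F, b.repr_apply_apply] using this

theorem LinearMap.IsSymmetric.inner_apply_self_eq_sum (hA : A.IsSymmetric)
    (hn : Module.finrank ℝ E = n) (x : E) :
    inner ℝ x (A x) =
      ∑ j, hA.eigenvalues hn j * ((hA.eigenvectorBasis hn).repr x j) ^ 2 := by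
  rw [← (hA.eigenvectorBasis hn).repr.inner_map_map, PiLp.inner_apply]
  refine Finset.sum_congr rfl fun j _ => ?_
  rw [hA.eigenvectorBasis_apply_self_apply]
  simp
  ring

/-- Courant–Fischer, upper bound: a quadratic form at most `c` on a subspace of codimension at most
`i` has at most `i` eigenvalues above `c`. -/
theorem LinearMap.IsSymmetric.eigenvalues_le_of_forall_mem (hA : A.IsSymmetric)
    (hn : Module.finrank ℝ E = n) (i : Fin n) (W : Submodule ℝ E) {c : ℝ}
    (hW : n ≤ Module.finrank ℝ W + i) (hc : ∀ x ∈ W, inner ℝ x (A x) ≤ c * ‖x‖ ^ 2) :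
    hA.eigenvalues hn i ≤ c := by
  set b := hA.eigenvectorBasis hn with hb
  -- Eigenvalues decrease with the index, so killing the coordinates beyond `i` leaves only
  -- eigenvalues at least the `i`-th. There are `n - 1 - i` of them, fewer than the dimension of
  -- `W`.
  obtain ⟨x, hxW, hx0, hx⟩ := b.exists_mem_ne_zero_repr_eq_zero W (Finset.Ioi i) (by
    rw [Fin.card_Ioi]; omega)
  have h1 := hc x hxW
  rw [hA.inner_apply_self_eq_sum hn, ← b.repr.norm_map x, EuclideanSpace.real_norm_sq_eq] at h1
  have h2 : hA.eigenvalues hn i * ∑ j, (b.repr x j) ^ 2 ≤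
      ∑ j, hA.eigenvalues hn j * (b.repr x j) ^ 2 := by
    rw [Finset.mul_sum]
    refine Finset.sum_le_sum fun j _ => ?_
    rcases le_or_gt j i with hj | hj
    · exact mul_le_mul_of_nonneg_right (hA.eigenvalues_antitone hn hj) (sq_nonneg _)
    · simp [hx j (Finset.mem_Ioi.2 hj)]
  have hpos : 0 < ∑ j, (b.repr x j) ^ 2 := by
    rw [← EuclideanSpace.real_norm_sq_eq, b.repr.norm_map]
    have := norm_pos_iff.2 hx0
    positivity
  exact le_of_mul_le_mul_right (h2.trans h1) hpos

/-- Courant–Fischer, lower bound: a quadratic form at least `c` on a subspace of dimension greater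
than `i` has more than `i` eigenvalues that are at least `c`. -/
theorem LinearMap.IsSymmetric.le_eigenvalues_of_forall_mem (hA : A.IsSymmetric)
    (hn : Module.finrank ℝ E = n) (i : Fin n) (W : Submodule ℝ E) {c : ℝ}
    (hW : (i : ℕ) < Module.finrank ℝ W) (hc : ∀ x ∈ W, c * ‖x‖ ^ 2 ≤ inner ℝ x (A x)) :
    c ≤ hA.eigenvalues hn i := by
  set b := hA.eigenvectorBasis hn with hb
  obtain ⟨x, hxW, hx0, hx⟩ := b.exists_mem_ne_zero_repr_eq_zero W (Finset.Iio i) (by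
    rw [Fin.card_Iio]; omega)
  have h1 := hc x hxW
  rw [hA.inner_apply_self_eq_sum hn, ← b.repr.norm_map x, EuclideanSpace.real_norm_sq_eq] at h1
  have h2 : ∑ j, hA.eigenvalues hn j * (b.repr x j) ^ 2 ≤
      hA.eigenvalues hn i * ∑ j, (b.repr x j) ^ 2 := by
    rw [Finset.mul_sum]
    refine Finset.sum_le_sum fun j _ => ?_
    rcases le_or_gt i j with hj | hj
    · exact mul_le_mul_of_nonneg_right (hA.eigenvalues_antitone hn hj) (sq_nonneg _)
    · simp [hx j (Finset.mem_Iio.2 hj)]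
  have hpos : 0 < ∑ j, (b.repr x j) ^ 2 := by
    rw [← EuclideanSpace.real_norm_sq_eq, b.repr.norm_map]
    have := norm_pos_iff.2 hx0
    positivity
  exact le_of_mul_le_mul_right (h1.trans h2) hpos

end CourantFischer

namespace OmittedFactors

/-! ### Eigenvalues of `R Rᵀ` through the columns of `R`. -/

section Eigenvalues

variable {T N : ℕ}

theorem inner_toEuclideanLin_mul_transpose (R : Matrix (Fin T) (Fin N) ℝ)
    (x : EuclideanSpace ℝ (Fin T)) :
    inner ℝ x ((R * R.transpose).toEuclideanLin x) =
      ∑ i, (inner ℝ (WithLp.toLp 2 fun t => R t i) x) ^ 2 := by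
  have h : ∀ i, inner ℝ (WithLp.toLp 2 fun t => R t i) x = (R.transpose.mulVec x.ofLp) i := by
    intro i
    simp [PiLp.inner_apply, Matrix.mulVec, dotProduct, mul_comm]
  simp only [h]
  rw [EuclideanSpace.inner_eq_star_dotProduct, Matrix.toLpLin_apply]
  rw [← Matrix.mulVec_mulVec, dotProduct_comm]
  simp only [star_trivial]
  rw [Matrix.dotProduct_mulVec, ← Matrix.mulVec_transpose]
  simp [dotProduct, sq]

theorem eigDesc_antitone {A : Matrix (Fin T) (Fin T) ℝ} (hA : A.IsHermitian) {j k : ℕ}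
    (hj : 1 ≤ j) (hjk : j ≤ k) (hk : k ≤ T) : eigDesc hA k ≤ eigDesc hA j := by
  rw [eigDesc, eigDesc, dif_pos ⟨hj.trans hjk, hk⟩, dif_pos ⟨hj, hjk.trans hk⟩]
  apply hA.eigenvalues₀_antitone
  simp only [Fin.mk_le_mk]
  omega

/-- `eigDesc` counts from one and the min-max bounds from zero, so index `k + 1` goes with
codimension `k`. -/
theorem eigDesc_mul_transpose_le (R : Matrix (Fin T) (Fin N) ℝ)
    (hA : (R * R.transpose).IsHermitian) {k : ℕ} (W : Submodule ℝ (EuclideanSpace ℝ (Fin T)))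
    {c : ℝ} (hk : k + 1 ≤ T) (hW : T ≤ Module.finrank ℝ W + k)
    (hc : ∀ x ∈ W, ∑ i, (inner ℝ (WithLp.toLp 2 fun t => R t i) x) ^ 2 ≤ c * ‖x‖ ^ 2) :
    eigDesc hA (k + 1) ≤ c := by
  rw [eigDesc, dif_pos ⟨by omega, hk⟩]
  apply LinearMap.IsSymmetric.eigenvalues_le_of_forall_mem _ _ _ W
  · simpa using hW
  · intro x hx
    exact (inner_toEuclideanLin_mul_transpose R x).trans_le (hc x hx)

theorem le_eigDesc_mul_transpose (R : Matrix (Fin T) (Fin N) ℝ)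
    (hA : (R * R.transpose).IsHermitian) {k : ℕ} (W : Submodule ℝ (EuclideanSpace ℝ (Fin T)))
    {c : ℝ} (hk : 1 ≤ k) (hkT : k ≤ T) (hW : k ≤ Module.finrank ℝ W)
    (hc : ∀ x ∈ W, c * ‖x‖ ^ 2 ≤ ∑ i, (inner ℝ (WithLp.toLp 2 fun t => R t i) x) ^ 2) :
    c ≤ eigDesc hA k := by
  rw [eigDesc, dif_pos ⟨hk, hkT⟩]
  apply LinearMap.IsSymmetric.le_eigenvalues_of_forall_mem _ _ _ W
  · simp only
    omega
  · intro x hx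
    exact (hc x hx).trans_eq (inner_toEuclideanLin_mul_transpose R x).symm

/-- Stated for every `k` because the criterion may be evaluated beyond the sample length, where the
default value `0` applies. -/
theorem eigDesc_mul_transpose_nonneg (R : Matrix (Fin T) (Fin N) ℝ)
    (hA : (R * R.transpose).IsHermitian) (k : ℕ) : 0 ≤ eigDesc hA k := by
  by_cases h : 1 ≤ k ∧ k ≤ T
  · refine le_eigDesc_mul_transpose R hA ⊤ h.1 h.2 (by simpa using h.2) fun x _ => ?_
    rw [zero_mul]
    positivity
  · rw [eigDesc, dif_neg h]

end Eigenvalues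

end OmittedFactors

namespace OmittedFactors

/-! ### Deterministic eigenvalue gap for a projected factor structure. -/

section ResidualEigenvalues

variable {T N : ℕ} {ι : Type*} [Fintype ι]
  (S : Submodule ℝ (EuclideanSpace ℝ (Fin T)))
  (U : ι → EuclideanSpace ℝ (Fin T)) (e : Fin N → EuclideanSpace ℝ (Fin T))
  (C : Fin N → ι → ℝ) (R : Matrix (Fin T) (Fin N) ℝ)

/-- The residual sample of a factor structure has at most as many eigenvalues above the noise level
as there are factors. -/
theorem eigDesc_residual_le
    (hR : ∀ i, WithLp.toLp 2 (fun t => R t i) = Sᗮ.starProjection (∑ a, C i a • U a + e i))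
    (hA : (R * R.transpose).IsHermitian) {c : ℝ} (hT : Fintype.card ι + 1 ≤ T)
    (he : ∀ x, ∑ i, (inner ℝ (e i) x) ^ 2 ≤ c * ‖x‖ ^ 2) (hc : 0 ≤ c) :
    eigDesc hA (Fintype.card ι + 1) ≤ c := by
  set V : Submodule ℝ (EuclideanSpace ℝ (Fin T)) :=
    Submodule.span ℝ (Set.range fun a => Sᗮ.starProjection (U a)) with hV
  have hdim : Module.finrank ℝ V ≤ Fintype.card ι := finrank_range_le_card _
  have hsum := V.finrank_add_finrank_orthogonal
  rw [finrank_euclideanSpace_fin] at hsum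
  refine eigDesc_mul_transpose_le R hA Vᗮ hT (by omega) fun x hx => ?_
  have horth : ∀ a, inner ℝ (U a) (Sᗮ.starProjection x) = 0 := by
    intro a
    rw [← Submodule.inner_starProjection_left_eq_right]
    exact (Submodule.mem_orthogonal _ _).1 hx _ (Submodule.subset_span ⟨a, rfl⟩)
  have heq : ∀ i, inner ℝ (WithLp.toLp 2 fun t => R t i) x =
      inner ℝ (e i) (Sᗮ.starProjection x) := by
    intro i
    rw [hR, Submodule.inner_starProjection_left_eq_right, inner_add_left, sum_inner]
    simp only [real_inner_smul_left, horth, mul_zero, Finset.sum_const_zero, zero_add]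
  simp only [heq]
  refine (he _).trans ?_
  have := Submodule.norm_starProjection_apply_le Sᗮ x
  gcongr

/-- If loadings and factors are strong, then the residual sample has as many eigenvalues well above
the noise level as there are factors. -/
theorem le_eigDesc_residual
    (hR : ∀ i, WithLp.toLp 2 (fun t => R t i) = Sᗮ.starProjection (∑ a, C i a • U a + e i))
    (hA : (R * R.transpose).IsHermitian) {c q s : ℝ} (hι : 1 ≤ Fintype.card ι)
    (hT : Fintype.card ι ≤ T)
    (he : ∀ x, ∑ i, (inner ℝ (e i) x) ^ 2 ≤ c * ‖x‖ ^ 2) (hq : 0 ≤ q) (hs : 0 < s)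
    (hC : ∀ w : ι → ℝ, q * ∑ a, w a ^ 2 ≤ ∑ i, (∑ a, C i a * w a) ^ 2)
    (hU : ∀ b : ι → ℝ, s * ∑ a, b a ^ 2 ≤ ‖Sᗮ.starProjection (∑ a, b a • U a)‖ ^ 2) :
    q * s / 2 - c ≤ eigDesc hA (Fintype.card ι) := by
  set V : Submodule ℝ (EuclideanSpace ℝ (Fin T)) :=
    Submodule.span ℝ (Set.range fun a => Sᗮ.starProjection (U a)) with hV
  -- The bound `hU` forces independence, so the test space has as many dimensions as there are
  -- factors.
  have hlin : LinearIndependent ℝ fun a => Sᗮ.starProjection (U a) := by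
    rw [Fintype.linearIndependent_iff]
    intro b hb a
    have h0 : s * ∑ a, b a ^ 2 ≤ 0 := by
      have := hU b
      rw [map_sum] at this
      simp only [map_smul] at this
      rwa [hb, norm_zero, zero_pow two_ne_zero] at this
    have h1 : ∑ a, b a ^ 2 = 0 :=
      le_antisymm (nonpos_of_mul_nonpos_right h0 hs) (by positivity)
    have := (Finset.sum_eq_zero_iff_of_nonneg fun a _ => sq_nonneg (b a)).1 h1 a (Finset.mem_univ _)
    exact pow_eq_zero_iff two_ne_zero |>.1 this
  refine le_eigDesc_mul_transpose R hA V hι hT (finrank_span_eq_card hlin).ge fun x hx => ?_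
  obtain ⟨b, rfl⟩ := (Submodule.mem_span_range_iff_exists_fun ℝ).1 hx
  set m := ∑ a, b a • Sᗮ.starProjection (U a) with hm
  have hm' : m = Sᗮ.starProjection (∑ a, b a • U a) := by simp [hm, map_sum]
  have hQm : Sᗮ.starProjection m = m := by
    rw [Submodule.starProjection_eq_self_iff, hm']
    exact Submodule.starProjection_apply_mem _ _
  set w : ι → ℝ := fun a => inner ℝ (U a) m with hw
  have heq : ∀ i, inner ℝ (WithLp.toLp 2 fun t => R t i) m =
      ∑ a, C i a * w a + inner ℝ (e i) m := by
    intro i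
    rw [hR, Submodule.inner_starProjection_left_eq_right, hQm, inner_add_left, sum_inner]
    simp [inner_smul_left, hw]
  have hbw : ∑ a, b a * w a = ‖m‖ ^ 2 := by
    have h : inner ℝ (Sᗮ.starProjection (∑ a, b a • U a)) m = ‖m‖ ^ 2 := by
      rw [← hm', real_inner_self_eq_norm_sq]
    rw [← h, Submodule.inner_starProjection_left_eq_right, hQm, sum_inner]
    simp only [real_inner_smul_left, hw]
  have hCS : (‖m‖ ^ 2) ^ 2 ≤ (∑ a, b a ^ 2) * ∑ a, w a ^ 2 := by
    rw [← hbw]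
    exact Finset.sum_mul_sq_le_sq_mul_sq _ _ _
  have hbs : s * ∑ a, b a ^ 2 ≤ ‖m‖ ^ 2 := hm' ▸ hU b
  -- With `‖m‖² = ∑ b w`, Cauchy–Schwarz gives `‖m‖⁴ ≤ |b|² |w|²`, and `|b|² ≤ ‖m‖² / s`; one factor
  -- `‖m‖²` cancels.
  have hws : s * ‖m‖ ^ 2 ≤ ∑ a, w a ^ 2 := by
    rcases (sq_nonneg ‖m‖).eq_or_lt with h0 | h0
    · rw [← h0, mul_zero]
      positivity
    · have hw0 : 0 ≤ ∑ a, w a ^ 2 := by positivity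
      refine le_of_mul_le_mul_right ?_ h0
      nlinarith [mul_le_mul_of_nonneg_right hbs hw0, mul_le_mul_of_nonneg_left hCS hs.le]
  have hCw : q * s * ‖m‖ ^ 2 ≤ ∑ i, (∑ a, C i a * w a) ^ 2 := by
    refine le_trans ?_ (hC w)
    rw [mul_assoc]
    exact mul_le_mul_of_nonneg_left hws hq
  -- From `x² ≤ 2 (x + y)² + 2 y²`; this is the source of the factor `1/2` and of the loss `c` in
  -- the conclusion.
  have hpar : ∑ i, (∑ a, C i a * w a) ^ 2 ≤
      2 * ∑ i, (∑ a, C i a * w a + inner ℝ (e i) m) ^ 2 + 2 * ∑ i, (inner ℝ (e i) m) ^ 2 := by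
    rw [Finset.mul_sum, Finset.mul_sum, ← Finset.sum_add_distrib]
    refine Finset.sum_le_sum fun i _ => ?_
    nlinarith [sq_nonneg (∑ a, C i a * w a + 2 * inner ℝ (e i) m)]
  simp only [heq]
  have := he m
  nlinarith

end ResidualEigenvalues

/-! ### Algebra of the first-pass residuals. -/

section Model

variable {Ω : Type*} {K Kz : ℕ} (M : FactorModel Ω K Kz)

/-- The sample path of an omitted factor, as a vector in `ℝ^T`. -/
def FactorModel.uvzPath (N T : ℕ) (ω : Ω) (a : Fin K ⊕ Fin Kz) :
    EuclideanSpace ℝ (Fin T) :=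
  WithLp.toLp 2 fun t => M.uvz N T t ω a

/-- The sample path of the noise of an asset, as a vector in `ℝ^T`. -/
def FactorModel.ePath (N T : ℕ) (ω : Ω) (i : Fin N) :
    EuclideanSpace ℝ (Fin T) :=
  WithLp.toLp 2 fun t => M.e N T t ω i

/-- The sample path of a proxy factor, as a vector in `ℝ^T`. -/
def FactorModel.gPath (T : ℕ) (ω : Ω) (k : Fin K) :
    EuclideanSpace ℝ (Fin T) :=
  WithLp.toLp 2 fun t => M.g t ω k

theorem FactorModel.one_mem_regressorSpan (T : ℕ) (ω : Ω) :
    (WithLp.toLp 2 fun _ => 1) ∈ M.regressorSpan T ω :=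
  Submodule.subset_span (Set.mem_insert _ _)

theorem FactorModel.gPath_mem_regressorSpan (T : ℕ) (ω : Ω) (k : Fin K) :
    M.gPath T ω k ∈ M.regressorSpan T ω := by
  have h : M.gPath T ω k = (WithLp.toLp 2 fun t : Fin T => M.gbar T t ω k) +
      ((T : ℝ)⁻¹ * ∑ s ∈ Finset.range T, M.g s ω k) • (WithLp.toLp 2 fun _ => 1) := by
    ext t
    simp [FactorModel.gPath, FactorModel.gbar]
  rw [h]
  exact add_mem (Submodule.subset_span (Set.mem_insert_of_mem _ ⟨k, rfl⟩))
    (Submodule.smul_mem _ _ (M.one_mem_regressorSpan T ω))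

/-- The intercept and the part of `f` that is affine in `g` lie in the span of the regressors for
every `ω`, so the projection removes them exactly. -/
theorem FactorModel.uhat_col [MeasurableSpace Ω] (μ : Measure Ω) (N T : ℕ) (ω : Ω) (i : Fin N) :
    WithLp.toLp 2 (fun t => M.uhat μ N T ω t i) =
      (M.regressorSpan T ω)ᗮ.starProjection
        (∑ a, M.cβγ N T ω i a • M.uvzPath N T ω a + M.ePath N T ω i) := by
  set S := M.regressorSpan T ω with hS
  -- The `i`-th row of `β d_g`: the exposure of the asset to the proxies themselves.
  set κ : Fin K → ℝ := fun l => ∑ k, M.β N T ω i k * M.dg N T k l with hκ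
  have hdecomp : (WithLp.toLp 2 (fun s : Fin T => M.r μ N T s ω i) : EuclideanSpace ℝ (Fin T)) =
      (∑ a, M.cβγ N T ω i a • M.uvzPath N T ω a + M.ePath N T ω i) +
      ((M.c N T ω i - ∑ l, κ l * M.μg μ l) • (WithLp.toLp 2 fun _ => 1) +
        ∑ l, κ l • M.gPath T ω l) := by
    ext t
    simp only [FactorModel.r, FactorModel.f, FactorModel.u, FactorModel.uvzPath,
      FactorModel.ePath, FactorModel.gPath, Fintype.sum_sum_type, FactorModel.cβγ,
      FactorModel.uvz, Matrix.mulVec_add, Matrix.mulVec_mulVec, Pi.add_apply, PiLp.add_apply,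
      PiLp.smul_apply, WithLp.ofLp_sum, Finset.sum_apply, WithLp.ofLp_smul, Pi.smul_apply,
      Matrix.fromCols_apply_inl, Matrix.fromCols_apply_inr, Sum.elim_inl, Sum.elim_inr,
      smul_eq_mul, Matrix.mulVec, dotProduct, Pi.sub_apply, mul_sub, Finset.sum_sub_distrib,
      Matrix.mul_apply, hκ]
    ring
  have hmem : ((M.c N T ω i - ∑ l, κ l * M.μg μ l) • (WithLp.toLp 2 fun _ => 1) +
        ∑ l, κ l • M.gPath T ω l) ∈ S :=
    add_mem (Submodule.smul_mem _ _ (M.one_mem_regressorSpan T ω))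
      (Submodule.sum_mem _ fun l _ => Submodule.smul_mem _ _ (M.gPath_mem_regressorSpan T ω l))
  have hcol : (WithLp.toLp 2 (fun t => M.uhat μ N T ω t i) : EuclideanSpace ℝ (Fin T)) =
      Sᗮ.starProjection (WithLp.toLp 2 (fun s : Fin T => M.r μ N T s ω i)) := by
    rw [Submodule.starProjection_orthogonal_val]
    rfl
  rw [hcol, hdecomp, map_add,
    Submodule.starProjection_orthogonal_apply_eq_zero hmem, add_zero]

end Model

end OmittedFactors

/-- A continuous function that is positive off zero and homogeneous of degree two dominates a
multiple of the squared norm. -/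
theorem exists_pos_forall_mul_norm_sq_le {V : Type*} [NormedAddCommGroup V] [NormedSpace ℝ V]
    [FiniteDimensional ℝ V] {q : V → ℝ} (hq : Continuous q)
    (hhom : ∀ (r : ℝ) x, q (r • x) = r ^ 2 * q x) (hpos : ∀ x, x ≠ 0 → 0 < q x) :
    ∃ c > 0, ∀ x, c * ‖x‖ ^ 2 ≤ q x := by
  have h0 : q 0 = 0 := by simpa using hhom 0 0
  rcases (Metric.sphere (0 : V) 1).eq_empty_or_nonempty with hS | hS
  · refine ⟨1, one_pos, fun x => ?_⟩
    have hx : x = 0 := by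
      by_contra hx
      have : ‖x‖⁻¹ • x ∈ Metric.sphere (0 : V) 1 := by
        simp [norm_smul, norm_ne_zero_iff.2 hx]
      simp [hS] at this
    simp [hx, h0]
  · obtain ⟨y, hy, hmin⟩ := (isCompact_sphere (0 : V) 1).exists_isMinOn hS hq.continuousOn
    refine ⟨q y, hpos y fun h => by simp [h] at hy, fun x => ?_⟩
    rcases eq_or_ne x 0 with rfl | hx
    · simp [h0]
    · have hx' : ‖x‖ ≠ 0 := norm_ne_zero_iff.2 hx
      have hmem : ‖x‖⁻¹ • x ∈ Metric.sphere (0 : V) 1 := by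
        simp [norm_smul, hx']
      have hle : q y ≤ q (‖x‖⁻¹ • x) := hmin hmem
      rw [hhom] at hle
      calc q y * ‖x‖ ^ 2 ≤ (‖x‖⁻¹ ^ 2 * q x) * ‖x‖ ^ 2 := by gcongr
        _ = q x := by field_simp

namespace OmittedFactors

/-! ### Lower bounds for sample Gram forms of stationary processes. -/

section StationaryGram

variable {E : Type*} [NormedAddCommGroup E] [InnerProductSpace ℝ E]

/-- The paths along which the Gram form of the first `n` values dominates `η ‖a‖ ^ 2` on the span of
the whole path. -/
def gramSet (E : Type*) [NormedAddCommGroup E] [InnerProductSpace ℝ E] (n : ℕ) (η : ℝ) :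
    Set (ℕ → E) :=
  {x | ∀ a ∈ Submodule.span ℝ (Set.range x),
    η * ‖a‖ ^ 2 ≤ ∑ s ∈ Finset.range n, (inner ℝ (x s) a) ^ 2}

/-- The span moves with the path, but its elements are finite combinations with coefficients `c`;
for each fixed `c` both sides are continuous in the path. This supplies measurability. -/
theorem isClosed_gramSet (n : ℕ) (η : ℝ) : IsClosed (gramSet E n η) := by
  have h : gramSet E n η = ⋂ c : ℕ →₀ ℝ, {x | η * ‖∑ i ∈ c.support, c i • x i‖ ^ 2 ≤
      ∑ s ∈ Finset.range n, (inner ℝ (x s) (∑ i ∈ c.support, c i • x i)) ^ 2} := by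
    ext x
    simp only [gramSet, Set.mem_ofPred_eq, Set.mem_iInter,
      Finsupp.mem_span_range_iff_exists_finsupp, forall_exists_index]
    exact ⟨fun h c => h _ c rfl, fun h a c hc => hc ▸ h c⟩
  rw [h]
  refine isClosed_iInter fun c => isClosed_le ?_ ?_ <;> fun_prop

theorem gramSet_mono {m n : ℕ} (hmn : m ≤ n) {η η' : ℝ} (hη : η ≤ η') :
    gramSet E m η' ⊆ gramSet E n η := by
  intro x hx a ha
  calc η * ‖a‖ ^ 2 ≤ η' * ‖a‖ ^ 2 := by gcongr
    _ ≤ _ := hx a ha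
    _ ≤ _ := Finset.sum_le_sum_of_subset_of_nonneg (Finset.range_mono hmn)
      fun _ _ _ => sq_nonneg _

variable [FiniteDimensional ℝ E]

/-- Finitely many values already span the whole span, and on it their Gram form is positive
definite, hence bounded below. A single integer `n` encodes both the window length and the constant,
so that the events increase to the whole space. -/
theorem exists_mem_gramSet (x : ℕ → E) : ∃ n : ℕ, x ∈ gramSet E n ((n : ℝ) + 1)⁻¹ := by
  set V := Submodule.span ℝ (Set.range x) with hV
  obtain ⟨f, hf, hspan, -⟩ := Submodule.exists_fun_fin_finrank_span_eq ℝ (Set.range x)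
  choose τ hτ using hf
  set m := Finset.univ.sup τ + 1 with hm
  obtain ⟨c, hc, hle⟩ := exists_pos_forall_mul_norm_sq_le (V := V)
    (q := fun a => ∑ s ∈ Finset.range m, (inner ℝ (x s) (a : E)) ^ 2) (by fun_prop)
    (fun r a => by
      rw [Finset.mul_sum]
      refine Finset.sum_congr rfl fun s _ => ?_
      rw [Submodule.coe_smul, real_inner_smul_right, mul_pow])
    (fun a ha => by
      refine (Finset.sum_nonneg fun s _ => sq_nonneg _).lt_of_ne' fun h0 => ha ?_
      rw [Finset.sum_eq_zero_iff_of_nonneg fun s _ => sq_nonneg _] at h0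
      have h1 : Submodule.span ℝ (Set.range f) ≤ (ℝ ∙ (a : E))ᗮ := by
        rw [Submodule.span_le]
        rintro _ ⟨i, rfl⟩
        rw [SetLike.mem_coe, Submodule.mem_orthogonal_singleton_iff_inner_left, ← hτ i]
        refine pow_eq_zero_iff two_ne_zero |>.1 (h0 _ (Finset.mem_range.2 ?_))
        have := Finset.le_sup (f := τ) (Finset.mem_univ i)
        omega
      rw [hspan] at h1
      have h2 := Submodule.mem_orthogonal_singleton_iff_inner_left.1 (h1 a.2)
      simpa using h2)
  obtain ⟨k, hk⟩ := exists_nat_one_div_lt hc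
  refine ⟨max m k, gramSet_mono (le_max_left m k) (η' := c) ?_ fun a ha => hle ⟨a, ha⟩⟩
  refine le_trans ?_ hk.le
  rw [one_div]
  gcongr
  exact le_max_right m k

/-- Rank at least `d` means that some `d` values are linearly independent, which is an open
condition. -/
theorem isOpen_le_finrank_span_range (d : ℕ) :
    IsOpen {x : ℕ → E | d ≤ Module.finrank ℝ (Submodule.span ℝ (Set.range x))} := by
  have h : {x : ℕ → E | d ≤ Module.finrank ℝ (Submodule.span ℝ (Set.range x))} =
      ⋃ τ : Fin d → ℕ, {x | LinearIndependent ℝ fun i => x (τ i)} := by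
    ext x
    simp only [Set.mem_ofPred_eq, Set.mem_iUnion]
    constructor
    · intro hd
      obtain ⟨f, hf, -, hlin⟩ := Submodule.exists_fun_fin_finrank_span_eq ℝ (Set.range x)
      choose τ hτ using hf
      refine ⟨fun i => τ (Fin.castLE hd i), ?_⟩
      simp only [hτ]
      exact hlin.comp _ (Fin.castLE_injective hd)
    · rintro ⟨τ, hτ⟩
      have h1 := finrank_span_eq_card hτ
      rw [Fintype.card_fin] at h1
      rw [← h1]
      exact Submodule.finrank_mono (Submodule.span_mono (Set.range_comp_subset_range τ x))
  rw [h]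
  refine isOpen_iUnion fun τ => ?_
  exact isOpen_setOfPred_linearIndependent.preimage
    (f := fun (x : ℕ → E) i => x (τ i)) (by fun_prop)

variable [MeasurableSpace E] [BorelSpace E] {ν : Measure (ℕ → E)} [IsProbabilityMeasure ν]

/-- Along almost every path of a stationary process, dropping initial values does not change the
span. -/
theorem ae_span_range_shift_eq {h : ℕ} (hν : MeasurePreserving (fun x t => x (t + h)) ν ν) :
    ∀ᵐ x ∂ν, Submodule.span ℝ (Set.range fun t => x (t + h)) =
      Submodule.span ℝ (Set.range x) := by
  have hle : ∀ x : ℕ → E, Submodule.span ℝ (Set.range fun t => x (t + h)) ≤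
      Submodule.span ℝ (Set.range x) := fun x =>
    Submodule.span_mono (Set.range_comp_subset_range (fun t => t + h) x)
  have hae : ∀ d : ℕ, ∀ᵐ x ∂ν,
      (d ≤ Module.finrank ℝ (Submodule.span ℝ (Set.range fun t => x (t + h))) ↔
        d ≤ Module.finrank ℝ (Submodule.span ℝ (Set.range x))) := by
    intro d
    have hmeas := (isOpen_le_finrank_span_range (E := E) d).measurableSet
    -- The shifted path can only have smaller rank, yet by stationarity both events have the same
    -- probability; nested events of equal finite measure agree almost everywhere.
    have := ae_eq_of_subset_of_measure_ge
      (s := (fun (x : ℕ → E) t => x (t + h)) ⁻¹'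
        {x : ℕ → E | d ≤ Module.finrank ℝ (Submodule.span ℝ (Set.range x))})
      (t := {x : ℕ → E | d ≤ Module.finrank ℝ (Submodule.span ℝ (Set.range x))})
      (fun x hx => le_trans hx (Submodule.finrank_mono (hle x)))
      (hν.measure_preimage hmeas.nullMeasurableSet).ge
      (hν.measurable hmeas).nullMeasurableSet (measure_ne_top _ _)
    exact this.mem_iff
  filter_upwards [ae_all_iff.2 hae] with x hx
  exact Submodule.eq_of_le_of_finrank_le (hle x) ((hx _).2 le_rfl)

/-- The sample Gram form of a stationary process dominates a multiple of `T ‖a‖ ^ 2` on the span of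
the path, up to an event of small probability. -/
theorem exists_gram_lower_bound
    (hν : ∀ h : ℕ, MeasurePreserving (fun x t => x (t + h)) ν ν) {δ : ℝ≥0∞} (hδ : 0 < δ) :
    ∃ η > 0, ∃ T₁ : ℕ, ∀ T ≥ T₁, ν (gramSet E T (η * T))ᶜ ≤ δ := by
  have hlim : Tendsto (fun n : ℕ => ν (gramSet E n ((n : ℝ) + 1)⁻¹)ᶜ) atTop (𝓝 0) := by
    have hanti : Antitone fun n : ℕ => (gramSet E n ((n : ℝ) + 1)⁻¹)ᶜ := by
      intro m n hmn
      refine Set.compl_subset_compl.2 (gramSet_mono hmn ?_)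
      gcongr
    have := tendsto_measure_iInter_atTop (μ := ν)
      (fun n => (isClosed_gramSet (E := E) n ((n : ℝ) + 1)⁻¹).measurableSet.compl.nullMeasurableSet)
      hanti ⟨0, measure_ne_top _ _⟩
    rwa [← Set.compl_iUnion, Set.eq_univ_of_forall fun x => Set.mem_iUnion.2 (exists_mem_gramSet x),
      Set.compl_univ, measure_empty] at this
  obtain ⟨n, hn⟩ := (hlim.eventually_le_const (ENNReal.half_pos hδ.ne')).exists
  set η : ℝ := ((n : ℝ) + 1)⁻¹ with hη
  have hη0 : 0 < η := by positivity
  set B : Set (ℕ → E) := (gramSet E n η)ᶜ with hB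
  have hBm : MeasurableSet B := (isClosed_gramSet n η).measurableSet.compl
  -- There are `T - n ≥ T/2` windows and more than half of them will be good, hence at least `T/4`.
  -- Each date lies in at most `n` windows; `n + 1` avoids division by zero.
  refine ⟨η / (4 * (n + 1)), by positivity, 2 * (n + 1), fun T hT => ?_⟩
  set m := T - n with hm
  have hm0 : 0 < m := by omega
  let count : (ℕ → E) → ℝ≥0∞ := fun x =>
    ∑ h ∈ Finset.range m, B.indicator 1 (fun t => x (t + h))
  have hterm : ∀ h, Measurable fun x : ℕ → E =>
      B.indicator (1 : (ℕ → E) → ℝ≥0∞) (fun t => x (t + h)) := fun h =>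
    (measurable_one.indicator hBm).comp (hν h).measurable
  have hcount : ∫⁻ x, count x ∂ν = m * ν B := by
    rw [lintegral_finsetSum _ fun h _ => hterm h]
    have : ∀ h ∈ Finset.range m,
        ∫⁻ x, B.indicator (1 : (ℕ → E) → ℝ≥0∞) (fun t => x (t + h)) ∂ν = ν B := by
      intro h _
      rw [(hν h).lintegral_comp (measurable_one.indicator hBm), lintegral_indicator_one hBm]
    rw [Finset.sum_congr rfl this, Finset.sum_const, Finset.card_range, nsmul_eq_mul]
  -- Each window is bad with the same probability, at most `δ/2`, so Markov's inequality bounds the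
  -- chance that half of them are bad.
  have hmarkov : ν {x | (m : ℝ≥0∞) / 2 ≤ count x} ≤ δ := by
    have h1 := mul_meas_ge_le_lintegral (μ := ν)
      (Finset.measurable_fun_sum (Finset.range m) fun h _ => hterm h) ((m : ℝ≥0∞) / 2)
    have hm2 : (m : ℝ≥0∞) ≠ 0 := by exact_mod_cast hm0.ne'
    have h2 : (m : ℝ≥0∞) * (2⁻¹ * ν {x | (m : ℝ≥0∞) / 2 ≤ count x}) ≤ m * ν B := by
      rw [← hcount, ← mul_assoc, ← div_eq_mul_inv]
      exact h1
    rw [ENNReal.mul_le_mul_iff_right hm2 (ENNReal.natCast_ne_top m)] at h2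
    have h3 := (h2.trans hn).trans_eq ENNReal.div_eq_inv_mul
    rwa [ENNReal.mul_le_mul_iff_right (by simp) (by simp)] at h3
  refine le_trans (measure_mono_ae ?_) hmarkov
  -- Every shifted path has the span of the full path, so one vector `a` may be tested against all
  -- good windows.
  filter_upwards [ae_all_iff.2 fun h => ae_span_range_shift_eq (hν h)] with x hx
  by_contra hcon
  obtain ⟨hnot, hlt⟩ := Classical.not_imp.1 hcon
  refine hnot fun a ha => ?_
  replace hlt : count x < (m : ℝ≥0∞) / 2 := not_le.1 hlt
  classical
  have hcard : count x = ((Finset.range m).filter fun h => (fun t => x (t + h)) ∈ B).card := by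
    rw [Finset.card_filter, Nat.cast_sum]
    refine Finset.sum_congr rfl fun h _ => ?_
    by_cases hh : (fun t => x (t + h)) ∈ B <;> simp [hh]
  have hbad : 2 * ((Finset.range m).filter fun h => (fun t => x (t + h)) ∈ B).card < m := by
    rw [hcard, ENNReal.lt_div_iff_mul_lt (by simp) (by simp), mul_comm] at hlt
    exact_mod_cast hlt
  have hsplit := Finset.card_filter_add_card_filter_not (s := Finset.range m)
    (fun h => (fun t => x (t + h)) ∈ B)
  rw [Finset.card_range] at hsplit
  set good := (Finset.range m).filter fun h => ¬ (fun t => x (t + h)) ∈ B with hgood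
  have hgoodcard : (T : ℝ) ≤ 4 * good.card := by
    have : T ≤ 4 * good.card := by omega
    exact_mod_cast this
  have hsum : good.card * (η * ‖a‖ ^ 2) ≤
      (n + 1) * ∑ t ∈ Finset.range T, (inner ℝ (x t) a) ^ 2 := by
    calc good.card * (η * ‖a‖ ^ 2) = ∑ h ∈ good, η * ‖a‖ ^ 2 := by
          rw [Finset.sum_const, nsmul_eq_mul]
      _ ≤ ∑ h ∈ good, ∑ s ∈ Finset.range n, (inner ℝ (x (s + h)) a) ^ 2 := by
          refine Finset.sum_le_sum fun h hh => ?_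
          have h1 : (fun t => x (t + h)) ∈ gramSet E n η := by
            simpa [hB] using (Finset.mem_filter.1 hh).2
          exact h1 a (by rwa [hx h])
      _ ≤ ∑ h ∈ Finset.range m, ∑ s ∈ Finset.range n, (inner ℝ (x (s + h)) a) ^ 2 :=
          Finset.sum_le_sum_of_subset_of_nonneg (Finset.filter_subset _ _)
            fun _ _ _ => by positivity
      _ = ∑ s ∈ Finset.range n, ∑ h ∈ Finset.range m, (inner ℝ (x (h + s)) a) ^ 2 := by
          rw [Finset.sum_comm]
          simp only [add_comm]
      _ ≤ ∑ s ∈ Finset.range n, ∑ t ∈ Finset.range T, (inner ℝ (x t) a) ^ 2 := by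
          refine Finset.sum_le_sum fun s hs => ?_
          refine (Finset.sum_map (Finset.range m) (addRightEmbedding s)
            fun t => (inner ℝ (x t) a) ^ 2).symm.trans_le ?_
          refine Finset.sum_le_sum_of_subset_of_nonneg ?_ fun _ _ _ => sq_nonneg _
          intro t ht
          simp only [Finset.mem_map, Finset.mem_range, addRightEmbedding_apply] at ht hs ⊢
          omega
      _ ≤ (n + 1) * ∑ t ∈ Finset.range T, (inner ℝ (x t) a) ^ 2 := by
          rw [Finset.sum_const, Finset.card_range, nsmul_eq_mul]
          gcongr
          simp
  have hn1 : (0 : ℝ) < n + 1 := by positivity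
  rw [div_mul_eq_mul_div, div_mul_eq_mul_div, div_le_iff₀ (by positivity)]
  have := mul_le_mul_of_nonneg_right hgoodcard (by positivity : 0 ≤ η * ‖a‖ ^ 2)
  linarith

end StationaryGram

end OmittedFactors

namespace OmittedFactors

/-! ### Events of probability tending to one. -/

section HighProbability

variable {Ω : Type*} [MeasurableSpace Ω] {μ : Measure Ω}

/-- The events `A N T` have probability tending to one as `N, T → ∞`. -/
def WithHighProb (μ : Measure Ω) (A : ℕ → ℕ → Ω → Prop) : Prop :=
  Tendsto (fun p : ℕ × ℕ => μ {ω | ¬ A p.1 p.2 ω}) (atTop ×ˢ atTop) (𝓝 0)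

theorem WithHighProb.mono {A B : ℕ → ℕ → Ω → Prop} (hA : WithHighProb μ A)
    (h : ∀ᶠ p : ℕ × ℕ in atTop ×ˢ atTop, ∀ ω, A p.1 p.2 ω → B p.1 p.2 ω) :
    WithHighProb μ B := by
  refine tendsto_of_tendsto_of_tendsto_of_le_of_le' tendsto_const_nhds hA
    (Eventually.of_forall fun _ => zero_le) ?_
  filter_upwards [h] with p hp
  exact measure_mono fun ω hω hAω => hω (hp ω hAω)

theorem WithHighProb.and {A B : ℕ → ℕ → Ω → Prop} (hA : WithHighProb μ A)
    (hB : WithHighProb μ B) : WithHighProb μ fun N T ω => A N T ω ∧ B N T ω := by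
  have h := Tendsto.add hA hB
  rw [add_zero] at h
  refine tendsto_of_tendsto_of_tendsto_of_le_of_le tendsto_const_nhds h
    (fun _ => zero_le) fun p => ?_
  refine (measure_mono fun ω hω => ?_).trans (measure_union_le _ _)
  exact not_and_or.1 hω

theorem WithHighProb.all {ι : Type*} [Fintype ι] {A : ι → ℕ → ℕ → Ω → Prop}
    (hA : ∀ i, WithHighProb μ (A i)) : WithHighProb μ fun N T ω => ∀ i, A i N T ω := by
  have h := tendsto_finsetSum Finset.univ fun i _ => hA i
  rw [Finset.sum_const_zero] at h
  refine tendsto_of_tendsto_of_tendsto_of_le_of_le tendsto_const_nhds h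
    (fun _ => zero_le) fun p => ?_
  refine (measure_mono fun ω hω => ?_).trans (measure_iUnion_fintype_le μ _)
  exact Set.mem_iUnion.2 (not_forall.1 hω)

theorem IsLittleOp.withHighProb {X : ℕ → ℕ → Ω → ℝ} (hX : IsLittleOp μ X) {ε : ℝ} (hε : 0 < ε) :
    WithHighProb μ fun N T ω => |X N T ω| < ε := by
  have h := tendstoInMeasure_iff_norm.1 hX ε hε
  simpa [WithHighProb] using h

theorem IsBigOp.withHighProb {X : ℕ → ℕ → Ω → ℝ} {a : ℕ → ℕ → ℝ} (hX : IsBigOp μ X a)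
    (ha : Tendsto (fun p : ℕ × ℕ => a p.1 p.2) (atTop ×ˢ atTop) (𝓝 0)) {ε : ℝ} (hε : 0 < ε) :
    WithHighProb μ fun N T ω => |X N T ω| < ε := by
  refine ENNReal.tendsto_nhds_zero.2 fun δ hδ => ?_
  obtain ⟨C, hC⟩ := hX δ hδ
  have hCa : Tendsto (fun p : ℕ × ℕ => C * a p.1 p.2) (atTop ×ˢ atTop) (𝓝 0) := by
    simpa using ha.const_mul C
  filter_upwards [hC, hCa.eventually_lt_const hε] with p hp hlt
  refine (measure_mono fun ω hω => ?_).trans hp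
  exact hlt.trans_le (not_lt.1 hω)

/-- Markov's inequality for double arrays. -/
theorem withHighProb_of_nnExp_le {X : ℕ → ℕ → Ω → ℝ} {b h : ℕ → ℕ → ℝ}
    (hX : ∀ N T, AEMeasurable (X N T) μ) (hb : ∀ N T, nnExp μ (X N T) ≤ ENNReal.ofReal (b N T))
    (hh : ∀ᶠ p : ℕ × ℕ in atTop ×ˢ atTop, 0 < h p.1 p.2)
    (hlim : Tendsto (fun p : ℕ × ℕ => b p.1 p.2 / h p.1 p.2) (atTop ×ˢ atTop) (𝓝 0)) :
    WithHighProb μ fun N T ω => X N T ω < h N T := by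
  have hlim' := ENNReal.tendsto_ofReal hlim
  rw [ENNReal.ofReal_zero] at hlim'
  refine tendsto_of_tendsto_of_tendsto_of_le_of_le' tendsto_const_nhds hlim'
    (Eventually.of_forall fun _ => zero_le) ?_
  filter_upwards [hh] with p hp
  have hmarkov := meas_ge_le_lintegral_div (hX p.1 p.2).ennreal_ofReal
    (ε := ENNReal.ofReal (h p.1 p.2)) (by simpa using hp) ENNReal.ofReal_ne_top
  rw [ENNReal.ofReal_div_of_pos hp]
  refine (measure_mono fun ω hω => ?_).trans (hmarkov.trans (by gcongr; exact hb _ _))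
  exact ENNReal.ofReal_le_ofReal (not_lt.1 hω)

theorem tendsto_inv_sqrt_natCast : Tendsto (fun n : ℕ => (√(n : ℝ))⁻¹) atTop (𝓝 0) :=
  (Real.tendsto_sqrt_atTop.comp tendsto_natCast_atTop_atTop).inv_tendsto_atTop

end HighProbability

/-! ### Perturbation of positive definite quadratic forms. -/

section QuadraticForms

variable {ι : Type*} [Fintype ι]

theorem sum_sum_mul_mul_le {D : ι → ι → ℝ} {ε : ℝ} (hε : 0 ≤ ε) (hD : ∀ a b, |D a b| ≤ ε)
    (w : ι → ℝ) :
    |∑ a, ∑ b, w a * w b * D a b| ≤ ε * (Fintype.card ι * ∑ a, w a ^ 2) := by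
  calc |∑ a, ∑ b, w a * w b * D a b| ≤ ∑ a, ∑ b, |w a| * |w b| * ε := by
        refine (Finset.abs_sum_le_sum_abs _ _).trans (Finset.sum_le_sum fun a _ => ?_)
        refine (Finset.abs_sum_le_sum_abs _ _).trans (Finset.sum_le_sum fun b _ => ?_)
        rw [abs_mul, abs_mul]
        gcongr
        exact hD a b
    _ = ε * (∑ a, |w a|) ^ 2 := by
        rw [sq, Finset.sum_mul_sum, Finset.mul_sum]
        refine Finset.sum_congr rfl fun a _ => ?_
        rw [Finset.mul_sum]
        exact Finset.sum_congr rfl fun b _ => by ring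
    _ ≤ ε * (Fintype.card ι * ∑ a, w a ^ 2) := by
        have := sq_sum_le_card_mul_sum_sq (s := Finset.univ) (f := fun a => |w a|)
        simp only [sq_abs, Finset.card_univ] at this
        gcongr

/-- Matrices close to a positive definite one are uniformly positive definite. -/
theorem exists_quadratic_form_lower_bound {Q : Matrix ι ι ℝ} (hQ : Q.PosDef) :
    ∃ q > 0, ∃ ε > 0, ∀ A : Matrix ι ι ℝ, (∀ a b, |A a b - Q a b| < ε) →
      ∀ w : ι → ℝ, q * ∑ a, w a ^ 2 ≤ ∑ a, ∑ b, w a * w b * A a b := by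
  obtain ⟨q, hq, hle⟩ := exists_pos_forall_mul_norm_sq_le (V := EuclideanSpace ℝ ι)
    (q := fun w => ∑ a, ∑ b, w a * w b * Q a b) (by fun_prop)
    (fun r w => by
      simp only [Finset.mul_sum, PiLp.smul_apply, smul_eq_mul]
      exact Finset.sum_congr rfl fun a _ => Finset.sum_congr rfl fun b _ => by ring)
    (fun w hw => by
      classical
      have h := hQ.dotProduct_mulVec_pos (x := w.ofLp) (by simpa using hw)
      simp only [dotProduct, Matrix.mulVec, star_trivial, Finset.mul_sum] at h
      refine h.trans_eq (Finset.sum_congr rfl fun a _ => Finset.sum_congr rfl fun b _ => by ring))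
  have hc : (0 : ℝ) < Fintype.card ι + 1 := by positivity
  -- Half of the lower bound `q` pays for the perturbation, which is at most `ε` times the number of
  -- indices; the `+ 1` covers an empty index type.
  refine ⟨q / 2, by positivity, q / 2 / (Fintype.card ι + 1), by positivity, fun A hA w => ?_⟩
  have h1 := hle (WithLp.toLp 2 w)
  rw [EuclideanSpace.real_norm_sq_eq] at h1
  have h2 := sum_sum_mul_mul_le (D := fun a b => A a b - Q a b) (by positivity)
    (fun a b => (hA a b).le) w
  have h3 : ∑ a, ∑ b, w a * w b * (A a b - Q a b) =
      ∑ a, ∑ b, w a * w b * A a b - ∑ a, ∑ b, w a * w b * Q a b := by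
    simp only [mul_sub, Finset.sum_sub_distrib]
  rw [h3] at h2
  have h4 : q / 2 / (Fintype.card ι + 1) * (Fintype.card ι * ∑ a, w a ^ 2) ≤
      q / 2 * ∑ a, w a ^ 2 := by
    have hs : 0 ≤ ∑ a, w a ^ 2 := by positivity
    calc q / 2 / (Fintype.card ι + 1) * (Fintype.card ι * ∑ a, w a ^ 2)
        ≤ q / 2 / (Fintype.card ι + 1) * ((Fintype.card ι + 1) * ∑ a, w a ^ 2) := by
          gcongr
          linarith
      _ = q / 2 * ∑ a, w a ^ 2 := by field_simp
  have h5 := (abs_le.1 h2).1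
  simp only at h1
  linarith

end QuadraticForms

/-! ### Projections controlled by cross moments. -/

section Projection

variable {E : Type*} [NormedAddCommGroup E] [InnerProductSpace ℝ E] [FiniteDimensional ℝ E]

/-- If the Gram form of the regressors is bounded below on their span, then the projection of a
vector on the column space of the regressors is controlled by its cross moments with them. -/
theorem norm_starProjection_sq_le_of_mem_gramSet {T : ℕ} {x : ℕ → E} {η : ℝ}
    (hx : x ∈ gramSet E T η) (hη : 0 ≤ η) (S : Submodule ℝ (EuclideanSpace ℝ (Fin T)))
    (hS : ∀ z ∈ S, ∃ a : E, ∀ t : Fin T, z t = inner ℝ (x t) a)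
    (y : EuclideanSpace ℝ (Fin T)) :
    η * ‖S.starProjection y‖ ^ 2 ≤ ‖∑ t : Fin T, y t • x t‖ ^ 2 := by
  set z := S.starProjection y with hz
  obtain ⟨a₀, ha₀⟩ := hS z (Submodule.starProjection_apply_mem _ _)
  set V := Submodule.span ℝ (Set.range x) with hV
  -- The Gram bound holds only on the span of the path. Projecting the coefficients there leaves all
  -- fitted values unchanged, so collinear regressors do no harm.
  set a := V.starProjection a₀ with ha
  have hza : ∀ t : Fin T, z t = inner ℝ (x t) a := by
    intro t
    have hmem : x t ∈ V := Submodule.subset_span ⟨(t : ℕ), rfl⟩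
    rw [ha₀, ha, ← Submodule.inner_starProjection_left_eq_right,
      Submodule.starProjection_eq_self_iff.2 hmem]
  have h1 : η * ‖a‖ ^ 2 ≤ ‖z‖ ^ 2 := by
    refine (hx a (Submodule.starProjection_apply_mem _ _)).trans_eq ?_
    rw [EuclideanSpace.real_norm_sq_eq, Finset.sum_range fun t => (inner ℝ (x t) a) ^ 2]
    simp only [hza]
  have h2 : ‖z‖ ^ 2 = inner ℝ (∑ t : Fin T, y t • x t) a := by
    have h : inner ℝ z y = ‖z‖ ^ 2 := by
      have hzz : S.starProjection z = z :=
        Submodule.starProjection_eq_self_iff.2 (Submodule.starProjection_apply_mem _ _)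
      rw [← hzz, Submodule.inner_starProjection_left_eq_right, ← hz, hzz,
        real_inner_self_eq_norm_sq]
    rw [← h, sum_inner, PiLp.inner_apply]
    refine Finset.sum_congr rfl fun t _ => ?_
    rw [real_inner_smul_left, hza]
    simp
  have h3 : ‖z‖ ^ 2 ≤ ‖∑ t : Fin T, y t • x t‖ * ‖a‖ := h2 ▸ real_inner_le_norm _ _
  set w := ‖∑ t : Fin T, y t • x t‖ with hw
  rcases (sq_nonneg ‖z‖).eq_or_lt with h0 | h0
  · rw [← h0, mul_zero]
    positivity
  -- `η ‖z‖⁴ ≤ η w² ‖a‖² ≤ w² ‖z‖²`, then one factor `‖z‖²` cancels.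
  · refine le_of_mul_le_mul_right ?_ h0
    have h4 : (‖z‖ ^ 2) ^ 2 ≤ w ^ 2 * ‖a‖ ^ 2 := by
      rw [← mul_pow]
      gcongr
    nlinarith [mul_le_mul_of_nonneg_left h4 hη, mul_le_mul_of_nonneg_left h1 (sq_nonneg w)]

end Projection

section StationaryGramOfProcess

theorem Stationary.comp {Ω E F : Type*} [MeasurableSpace Ω] [MeasurableSpace E]
    [MeasurableSpace F] {μ : Measure Ω} {X : ℕ → Ω → F} (hX : Stationary μ X) {f : F → E}
    (hf : Measurable f) : Stationary μ fun t ω => f (X t ω) := fun h =>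
  (hX h).comp (u := fun x t => f (x t)) (measurable_pi_lambda _ fun t => by fun_prop)

variable {Ω E : Type*} [MeasurableSpace Ω] [NormedAddCommGroup E] [InnerProductSpace ℝ E]
  [FiniteDimensional ℝ E] [MeasurableSpace E] [BorelSpace E]

/-- Stationarity says exactly that the law on path space is shift invariant, so the bound for such
laws pulls back to `Ω`. -/
theorem Stationary.exists_gram_lower_bound {μ : Measure Ω} [IsProbabilityMeasure μ]
    {X : ℕ → Ω → E} (hX : Stationary μ X) {δ : ℝ≥0∞} (hδ : 0 < δ) :
    ∃ η > 0, ∃ T₁ : ℕ, ∀ T ≥ T₁, μ {ω | ¬ (fun t => X t ω) ∈ gramSet E T (η * T)} ≤ δ := by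
  have hmeas : AEMeasurable (fun ω t => X t ω) μ := (hX 0).aemeasurable_snd
  have : IsProbabilityMeasure (μ.map fun ω t => X t ω) := Measure.isProbabilityMeasure_map hmeas
  have hshift : ∀ h : ℕ, Measurable fun (x : ℕ → E) t => x (t + h) := fun h =>
    measurable_pi_lambda _ fun t => measurable_pi_apply _
  obtain ⟨η, hη, T₁, hT₁⟩ := OmittedFactors.exists_gram_lower_bound
    (ν := μ.map fun ω t => X t ω) (fun h => ⟨hshift h, by
      rw [AEMeasurable.map_map_of_aemeasurable (hshift h).aemeasurable hmeas]
      exact (hX h).map_eq⟩) hδ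
  exact ⟨η, hη, T₁, fun T hT => (Measure.le_map_apply hmeas _).trans (hT₁ T hT)⟩

end StationaryGramOfProcess

end OmittedFactors

namespace OmittedFactors

/-! ### The size of the noise relative to the penalty. -/

section Noise

/-- The operator norm of the `T × T` matrix of cross products is at most its Frobenius norm:
Cauchy–Schwarz over pairs of dates. -/
theorem sum_inner_sq_sq_le {N T : ℕ} (e : Fin N → EuclideanSpace ℝ (Fin T))
    (z : EuclideanSpace ℝ (Fin T)) :
    (∑ i, (inner ℝ (e i) z) ^ 2) ^ 2 ≤
      (∑ t, ∑ t', (∑ i, e i t * e i t') ^ 2) * (‖z‖ ^ 2) ^ 2 := by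
  have h1 : ∑ i, (inner ℝ (e i) z) ^ 2 =
      ∑ p : Fin T × Fin T, (∑ i, e i p.1 * e i p.2) * (z p.1 * z p.2) := by
    simp only [PiLp.inner_apply, RCLike.inner_apply, conj_trivial, sq, Finset.sum_mul_sum,
      Fintype.sum_prod_type]
    simp only [Finset.sum_mul]
    rw [Finset.sum_comm]
    refine Finset.sum_congr rfl fun t _ => ?_
    rw [Finset.sum_comm]
    exact Finset.sum_congr rfl fun t' _ => Finset.sum_congr rfl fun i _ => by ring
  have h2 : (‖z‖ ^ 2) ^ 2 = ∑ p : Fin T × Fin T, (z p.1 * z p.2) ^ 2 := by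
    rw [EuclideanSpace.real_norm_sq_eq, sq, Finset.sum_mul_sum, Fintype.sum_prod_type]
    simp only [mul_pow]
  rw [h1, h2, ← Fintype.sum_prod_type' fun t t' => (∑ i, e i t * e i t') ^ 2]
  exact Finset.sum_mul_sq_le_sq_mul_sq _ _ _

variable {Ω : Type*} {K Kz : ℕ} {M : FactorModel Ω K Kz} [MeasurableSpace Ω] {μ : Measure Ω}

theorem FactorModel.integral_sum_e_mul_e (N T t t' : ℕ) :
    ∫ ω, ∑ i, M.e N T t ω i * M.e N T t' ω i ∂μ = N * M.γN μ N T t t' := by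
  rw [FactorModel.γN, integral_const_mul]
  rcases Nat.eq_zero_or_pos N with rfl | hN
  · simp
  · have : (N : ℝ) ≠ 0 := by positivity
    field_simp

theorem FactorModel.WellPosed.aemeasurable_e (hwell : M.WellPosed μ) (N T t : ℕ) (i : Fin N) :
    AEMeasurable (fun ω => M.e N T t ω i) μ :=
  (hwell.e_memLp N T t i).aestronglyMeasurable.aemeasurable

theorem FactorModel.WellPosed.aemeasurable_sum_e_mul_e (hwell : M.WellPosed μ) (N T t t' : ℕ) :
    AEMeasurable (fun ω => ∑ i, M.e N T t ω i * M.e N T t' ω i) μ :=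
  Finset.aemeasurable_fun_sum _ fun i _ =>
    (hwell.aemeasurable_e N T t i).mul (hwell.aemeasurable_e N T t' i)

/-- The expected squared Frobenius norm of the `T × T` matrix of noise cross products. -/
theorem FactorModel.WeakNoise.exists_nnExp_le [IsProbabilityMeasure μ] (hwell : M.WellPosed μ)
    (hnoise : M.WeakNoise μ) : ∃ L : ℝ, 0 ≤ L ∧ ∀ N T : ℕ,
      nnExp μ (fun ω => ∑ t ∈ Finset.range T, ∑ t' ∈ Finset.range T,
        (∑ i, M.e N T t ω i * M.e N T t' ω i) ^ 2) ≤
      ENNReal.ofReal (2 * N ^ 2 * L ^ 2 * T + 2 * T ^ 2 * (L * N)) := by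
  obtain ⟨L, hL⟩ := hnoise
  have hL0 : 0 ≤ L := by simpa using (hL 0 0).1
  refine ⟨L, hL0, fun N T => ?_⟩
  obtain ⟨h1, h2, h3⟩ := hL N T
  rcases Nat.eq_zero_or_pos T with rfl | hT
  · simp [nnExp]
  have hT' : (0 : ℝ) < T := by exact_mod_cast hT
  set γ := M.γN μ N T with hγ
  set D : ℕ → ℕ → Ω → ℝ := fun t t' ω => ∑ i, M.e N T t ω i * M.e N T t' ω i
    - ∫ ω', ∑ i, M.e N T t ω' i * M.e N T t' ω' i ∂μ with hD
  have hDm : ∀ t t', AEMeasurable (D t t') μ := fun t t' =>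
    (hwell.aemeasurable_sum_e_mul_e N T t t').sub_const _
  -- One factor `|γ|` is bounded uniformly by `L`; the other is summed.
  have hγsum : ∑ t ∈ Finset.range T, ∑ t' ∈ Finset.range T, γ t t' ^ 2 ≤ L ^ 2 * T := by
    calc ∑ t ∈ Finset.range T, ∑ t' ∈ Finset.range T, γ t t' ^ 2
        ≤ ∑ t ∈ Finset.range T, ∑ t' ∈ Finset.range T, L * |γ t t'| := by
          refine Finset.sum_le_sum fun t ht => Finset.sum_le_sum fun t' ht' => ?_
          rw [← sq_abs, sq]
          exact mul_le_mul_of_nonneg_right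
            (h2 t (Finset.mem_range.1 ht) t' (Finset.mem_range.1 ht')) (abs_nonneg _)
      _ = L * ∑ t ∈ Finset.range T, ∑ t' ∈ Finset.range T, |γ t t'| := by
          simp only [Finset.mul_sum]
      _ ≤ L * (L * T) := by
          rw [inv_mul_le_iff₀ hT'] at h1
          gcongr
          linarith
      _ = L ^ 2 * T := by ring
  have hpt : ∀ ω, ENNReal.ofReal (∑ t ∈ Finset.range T, ∑ t' ∈ Finset.range T,
        (∑ i, M.e N T t ω i * M.e N T t' ω i) ^ 2) ≤
      ENNReal.ofReal (2 * N ^ 2 * L ^ 2 * T) +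
        2 * ∑ t ∈ Finset.range T, ∑ t' ∈ Finset.range T, ENNReal.ofReal (D t t' ω ^ 2) := by
    intro ω
    have hreal : ∑ t ∈ Finset.range T, ∑ t' ∈ Finset.range T,
        (∑ i, M.e N T t ω i * M.e N T t' ω i) ^ 2 ≤ 2 * N ^ 2 * L ^ 2 * T +
          2 * ∑ t ∈ Finset.range T, ∑ t' ∈ Finset.range T, D t t' ω ^ 2 := by
      calc ∑ t ∈ Finset.range T, ∑ t' ∈ Finset.range T,
            (∑ i, M.e N T t ω i * M.e N T t' ω i) ^ 2
          ≤ ∑ t ∈ Finset.range T, ∑ t' ∈ Finset.range T,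
            (2 * N ^ 2 * γ t t' ^ 2 + 2 * D t t' ω ^ 2) := by
            refine Finset.sum_le_sum fun t _ => Finset.sum_le_sum fun t' _ => ?_
            have h : ∑ i, M.e N T t ω i * M.e N T t' ω i = N * γ t t' + D t t' ω := by
              simp only [hD, M.integral_sum_e_mul_e]
              ring
            rw [h]
            nlinarith [sq_nonneg (N * γ t t' - D t t' ω)]
        _ = 2 * N ^ 2 * ∑ t ∈ Finset.range T, ∑ t' ∈ Finset.range T, γ t t' ^ 2 +
            2 * ∑ t ∈ Finset.range T, ∑ t' ∈ Finset.range T, D t t' ω ^ 2 := by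
            simp only [Finset.sum_add_distrib, Finset.mul_sum]
        _ ≤ 2 * N ^ 2 * (L ^ 2 * T) +
            2 * ∑ t ∈ Finset.range T, ∑ t' ∈ Finset.range T, D t t' ω ^ 2 := by gcongr
        _ = _ := by ring
    refine (ENNReal.ofReal_le_ofReal hreal).trans_eq ?_
    rw [ENNReal.ofReal_add (by positivity) (by positivity), ENNReal.ofReal_mul two_pos.le,
      ENNReal.ofReal_ofNat,
      ENNReal.ofReal_sum_of_nonneg fun t _ => Finset.sum_nonneg fun t' _ => sq_nonneg _]
    simp only [ENNReal.ofReal_sum_of_nonneg fun t' _ => sq_nonneg (D _ t' ω)]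
  have hDsum : ∫⁻ ω, ∑ t ∈ Finset.range T, ∑ t' ∈ Finset.range T,
      ENNReal.ofReal (D t t' ω ^ 2) ∂μ ≤ ENNReal.ofReal (T ^ 2 * (L * N)) := by
    have hm : ∀ t t', AEMeasurable (fun ω => ENNReal.ofReal (D t t' ω ^ 2)) μ := fun t t' =>
      ((hDm t t').pow_const 2).ennreal_ofReal
    rw [lintegral_finsetSum' _ fun t _ => Finset.aemeasurable_fun_sum _ fun t' _ => hm t t']
    simp only [lintegral_finsetSum' _ fun t' _ => hm _ t']
    have hTT : ENNReal.ofReal ((T : ℝ) ^ 2) * ENNReal.ofReal (((T : ℝ) ^ 2)⁻¹) = 1 := by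
      rw [← ENNReal.ofReal_mul (by positivity), mul_inv_cancel₀ (by positivity),
        ENNReal.ofReal_one]
    have := mul_le_mul_right h3 (ENNReal.ofReal ((T : ℝ) ^ 2))
    rwa [← mul_assoc, hTT, one_mul, ← ENNReal.ofReal_mul (by positivity)] at this
  have hDm2 : AEMeasurable (fun ω => ∑ t ∈ Finset.range T, ∑ t' ∈ Finset.range T,
      ENNReal.ofReal (D t t' ω ^ 2)) μ :=
    Finset.aemeasurable_fun_sum _ fun t _ => Finset.aemeasurable_fun_sum _ fun t' _ =>
      ((hDm t t').pow_const 2).ennreal_ofReal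
  have htwo : ENNReal.ofReal (2 * T ^ 2 * (L * N)) = 2 * ENNReal.ofReal (T ^ 2 * (L * N)) := by
    rw [mul_assoc, ENNReal.ofReal_mul two_pos.le, ENNReal.ofReal_ofNat]
  refine (lintegral_mono hpt).trans ?_
  rw [lintegral_add_left measurable_const, lintegral_const, measure_univ, mul_one,
    lintegral_const_mul'' _ hDm2, ENNReal.ofReal_add (by positivity) (by positivity), htwo]
  gcongr

/-- The noise contributes less than the penalty to the eigenvalues. -/
theorem FactorModel.WeakNoise.withHighProb [IsProbabilityMeasure μ] (hwell : M.WellPosed μ)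
    (hnoise : M.WeakNoise μ) {φ : ℕ → ℕ → ℝ}
    (hφ_pos : ∀ᶠ p : ℕ × ℕ in atTop ×ˢ atTop, 0 < φ p.1 p.2)
    (hφ_rate : Tendsto (fun p : ℕ × ℕ => φ p.1 p.2 / ((√(p.1 : ℝ))⁻¹ + (√(p.2 : ℝ))⁻¹))
      (atTop ×ˢ atTop) atTop) :
    WithHighProb μ fun N T ω => ∀ x, ∑ i, (inner ℝ (M.ePath N T ω i) x) ^ 2 ≤
      N * T * (φ N T / 2) * ‖x‖ ^ 2 := by
  obtain ⟨L, hL0, hL⟩ := hnoise.exists_nnExp_le hwell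
  have hpos : ∀ᶠ p : ℕ × ℕ in atTop ×ˢ atTop, 0 < p.1 ∧ 0 < p.2 :=
    (eventually_gt_atTop 0).prod_mk (eventually_gt_atTop 0)
  have hev : WithHighProb μ fun N T ω => ∑ t ∈ Finset.range T, ∑ t' ∈ Finset.range T,
      (∑ i, M.e N T t ω i * M.e N T t' ω i) ^ 2 < (N * T * (φ N T / 2)) ^ 2 := by
    refine withHighProb_of_nnExp_le (fun N T => ?_) hL ?_ ?_
    · exact Finset.aemeasurable_fun_sum _ fun t _ => Finset.aemeasurable_fun_sum _ fun t' _ =>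
        (hwell.aemeasurable_sum_e_mul_e N T t t').pow_const 2
    · filter_upwards [hφ_pos, hpos] with p h1 h2
      have := h2.1
      have := h2.2
      positivity
    -- The Markov ratio equals `8 (L²/T + L/N) / φ²`, and `1/N + 1/T ≤ (N^{-1/2} + T^{-1/2})²`, so
    -- it vanishes by the rate condition on `φ`.
    · have hlim : Tendsto (fun p : ℕ × ℕ =>
          8 * (L ^ 2 + L) * ((φ p.1 p.2 / ((√(p.1 : ℝ))⁻¹ + (√(p.2 : ℝ))⁻¹))⁻¹) ^ 2)
          (atTop ×ˢ atTop) (𝓝 0) := by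
        simpa using (hφ_rate.inv_tendsto_atTop.pow 2).const_mul (8 * (L ^ 2 + L))
      refine tendsto_of_tendsto_of_tendsto_of_le_of_le' tendsto_const_nhds hlim
        (Eventually.of_forall fun p => by positivity) ?_
      filter_upwards [hφ_pos, hpos] with p h1 h2
      obtain ⟨N, T⟩ := p
      simp only at h1 h2 ⊢
      have hN : (0 : ℝ) < N := by exact_mod_cast h2.1
      have hT : (0 : ℝ) < T := by exact_mod_cast h2.2
      rw [inv_div, div_pow, ← mul_div_assoc (8 * (L ^ 2 + L)),
        div_le_div_iff₀ (by positivity) (by positivity)]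
      have ha : (N : ℝ)⁻¹ + (T : ℝ)⁻¹ ≤ ((√(N : ℝ))⁻¹ + (√(T : ℝ))⁻¹) ^ 2 := by
        have h3 : ((√(N : ℝ))⁻¹) ^ 2 = (N : ℝ)⁻¹ := by rw [inv_pow, Real.sq_sqrt hN.le]
        have h4 : ((√(T : ℝ))⁻¹) ^ 2 = (T : ℝ)⁻¹ := by rw [inv_pow, Real.sq_sqrt hT.le]
        have h5 : 0 ≤ (√(N : ℝ))⁻¹ * (√(T : ℝ))⁻¹ := by positivity
        nlinarith
      calc (2 * (N : ℝ) ^ 2 * L ^ 2 * T + 2 * T ^ 2 * (L * N)) * φ N T ^ 2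
          = 8 * (L ^ 2 * (T : ℝ)⁻¹ + L * (N : ℝ)⁻¹) * (N * T * (φ N T / 2)) ^ 2 := by
            field_simp
            ring
        _ ≤ 8 * ((L ^ 2 + L) * ((√(N : ℝ))⁻¹ + (√(T : ℝ))⁻¹) ^ 2) *
            (N * T * (φ N T / 2)) ^ 2 := by
            have h6 : L ^ 2 * (T : ℝ)⁻¹ + L * (N : ℝ)⁻¹ ≤
                (L ^ 2 + L) * ((N : ℝ)⁻¹ + (T : ℝ)⁻¹) := by
              have : 0 ≤ L ^ 2 * (N : ℝ)⁻¹ + L * (T : ℝ)⁻¹ := by positivity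
              linarith
            have h7 := mul_le_mul_of_nonneg_left ha (by positivity : 0 ≤ L ^ 2 + L)
            have h8 := h6.trans h7
            gcongr
        _ = _ := by ring
  refine hev.mono ?_
  filter_upwards [hφ_pos] with p hp ω hω x
  have h1 := sum_inner_sq_sq_le (M.ePath p.1 p.2 ω) x
  rw [Finset.sum_range] at hω
  simp only [Finset.sum_range] at hω
  refine abs_le_of_sq_le_sq' ?_ (by positivity) |>.2
  rw [mul_pow]
  refine h1.trans ?_
  gcongr
  exact hω.le

end Noise

/-! ### The regressors do not absorb the omitted factors. -/

section OmittedFactorProjection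

/-- The regressors of the first pass at one date: the constant and the proxies. -/
def withIntercept {K : ℕ} (g : Fin K → ℝ) : EuclideanSpace ℝ (Option (Fin K)) :=
  WithLp.toLp 2 fun o => o.elim 1 g

theorem measurable_withIntercept {K : ℕ} : Measurable (withIntercept (K := K)) := by
  refine (WithLp.measurable_toLp 2 _).comp (measurable_pi_lambda _ fun o => ?_)
  cases o
  · exact measurable_const
  · exact measurable_pi_apply _

theorem inner_withIntercept {K : ℕ} (g : Fin K → ℝ) (a : EuclideanSpace ℝ (Option (Fin K))) :
    inner ℝ (withIntercept g) a = a none + ∑ k, g k * a (some k) := by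
  simp [withIntercept, PiLp.inner_apply, Fintype.sum_option, mul_comm]

/-- Demeaning is absorbed by the intercept. This lets the Gram bound be applied to the stationary
process `(1, g_t)`; the demeaned proxies depend on `T` and on the whole sample. -/
theorem FactorModel.exists_eq_inner_of_mem_regressorSpan {Ω : Type*} {K Kz : ℕ}
    {M : FactorModel Ω K Kz} {T : ℕ} {ω : Ω}
    {z : EuclideanSpace ℝ (Fin T)} (hz : z ∈ M.regressorSpan T ω) :
    ∃ a, ∀ t : Fin T, z t = inner ℝ (withIntercept (M.g t ω)) a := by
  induction hz using Submodule.span_induction with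
  | mem z hz =>
    rcases hz with rfl | ⟨k, rfl⟩
    · refine ⟨EuclideanSpace.single none 1, fun t => ?_⟩
      simp [inner_withIntercept]
    · refine ⟨EuclideanSpace.single (some k) 1 - ((T : ℝ)⁻¹ * ∑ s ∈ Finset.range T, M.g s ω k) •
        EuclideanSpace.single none 1, fun t => ?_⟩
      simp [inner_withIntercept, FactorModel.gbar]
      ring
  | zero => exact ⟨0, fun t => by simp⟩
  | add y z _ _ hy hz =>
    obtain ⟨a, ha⟩ := hy
    obtain ⟨b, hb⟩ := hz
    exact ⟨a + b, fun t => by rw [inner_add_right, ← ha, ← hb, PiLp.add_apply]⟩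
  | smul r z _ hz =>
    obtain ⟨a, ha⟩ := hz
    exact ⟨r • a, fun t => by rw [inner_smul_right, ← ha, PiLp.smul_apply, smul_eq_mul]⟩

variable {Ω : Type*} {K Kz : ℕ} {M : FactorModel Ω K Kz} [MeasurableSpace Ω] {μ : Measure Ω}

/-- The sums scaled by `T^{-1/2}` have bounded second moments, so scaling by `T^{-1}` sends them to
zero. -/
theorem FactorModel.WeakDependence.withHighProb (hwell : M.WellPosed μ) (hbase : M.Baseline μ)
    (hK : 1 ≤ K) (hdep : M.WeakDependence μ) (k : Fin K) (a : Fin K ⊕ Fin Kz) {ε : ℝ}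
    (hε : 0 < ε) :
    WithHighProb μ fun N T ω =>
      |(T : ℝ)⁻¹ * ∑ t ∈ Finset.range T, M.g t ω k * M.uvz N T t ω a| < ε := by
  obtain ⟨L, hL⟩ := hdep
  have hg : ∀ t k, AEMeasurable (fun ω => M.g t ω k) μ := fun t k =>
    (hbase.g_memLp t k).aestronglyMeasurable.aemeasurable
  have hu : ∀ N T t a, AEMeasurable (fun ω => M.uvz N T t ω a) μ := by
    rintro N T t (l | l)
    · exact (hbase.v_memLp N T t l).aestronglyMeasurable.aemeasurable
    · exact aemeasurable_pi_iff.1 (hwell.z_meas N T t) l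
  have hKK : (0 : ℝ) < ((K + Kz : ℕ) : ℝ) := by exact_mod_cast (by omega : 0 < K + Kz)
  have hpos : ∀ᶠ p : ℕ × ℕ in atTop ×ˢ atTop, 0 < p.2 :=
    tendsto_snd.eventually (eventually_gt_atTop 0)
  have hev := withHighProb_of_nnExp_le (μ := μ) (b := fun _ _ => L)
    (h := fun _ T => ((K + Kz : ℕ) : ℝ)⁻¹ * (T * ε ^ 2)) (fun N T => ?_)
    (fun N T => (hL N T).2.1) ?_ ?_
  · refine hev.mono ?_
    filter_upwards [hpos] with p hp ω hω
    obtain ⟨N, T⟩ := p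
    simp only at hp hω ⊢
    have hT : (0 : ℝ) < T := by exact_mod_cast hp
    have hlt := lt_of_mul_lt_mul_left hω (by positivity)
    set S := ∑ t ∈ Finset.range T, M.g t ω k * M.uvz N T t ω a with hS
    have hle : ((√(T : ℝ))⁻¹ * S) ^ 2 ≤ ∑ a, ∑ k,
        ((√(T : ℝ))⁻¹ * ∑ t ∈ Finset.range T, M.g t ω k * M.uvz N T t ω a) ^ 2 := by
      refine le_trans ?_ (Finset.single_le_sum (f := fun a => ∑ k,
        ((√(T : ℝ))⁻¹ * ∑ t ∈ Finset.range T, M.g t ω k * M.uvz N T t ω a) ^ 2)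
        (fun _ _ => by positivity) (Finset.mem_univ a))
      exact Finset.single_le_sum (f := fun k =>
        ((√(T : ℝ))⁻¹ * ∑ t ∈ Finset.range T, M.g t ω k * M.uvz N T t ω a) ^ 2)
        (fun _ _ => by positivity) (Finset.mem_univ k)
    have h1 := hle.trans_lt hlt
    rw [mul_pow, inv_pow, Real.sq_sqrt hT.le] at h1
    refine abs_lt_of_sq_lt_sq ?_ hε.le
    calc ((T : ℝ)⁻¹ * S) ^ 2 = (T : ℝ)⁻¹ * ((T : ℝ)⁻¹ * S ^ 2) := by ring
      _ < (T : ℝ)⁻¹ * (T * ε ^ 2) := by gcongr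
      _ = ε ^ 2 := by field_simp
  · refine AEMeasurable.const_mul (Finset.aemeasurable_fun_sum _ fun a _ =>
      Finset.aemeasurable_fun_sum _ fun k _ => ?_) _
    exact ((Finset.aemeasurable_fun_sum _ fun t _ =>
      (hg t k).mul (hu N T t a)).const_mul _).pow_const 2
  · filter_upwards [hpos] with p hp
    positivity
  · refine Tendsto.div_atTop tendsto_const_nhds ?_
    refine Tendsto.const_mul_atTop (by positivity) (Tendsto.atTop_mul_const (by positivity) ?_)
    exact tendsto_natCast_atTop_atTop.comp tendsto_snd

/-- The regressors explain a negligible share of the omitted factors. -/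
theorem FactorModel.withHighProb_projection_uvzPath [IsProbabilityMeasure μ]
    (hwell : M.WellPosed μ) (hbase : M.Baseline μ) (hK : 1 ≤ K) (hdep : M.WeakDependence μ)
    (hmeans : M.OmittedFactorMeans μ) (a : Fin K ⊕ Fin Kz) {ε : ℝ} (hε : 0 < ε) :
    WithHighProb μ fun N T ω =>
      ‖(M.regressorSpan T ω).starProjection (M.uvzPath N T ω a)‖ ^ 2 ≤ ε * T := by
  -- The Gram constant `η` depends on the tolerated probability `δ`, so `δ` is fixed first.
  refine ENNReal.tendsto_nhds_zero.2 fun δ hδ => ?_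
  obtain ⟨η, hη, T₁, hT₁⟩ := (hbase.g_stationary.comp
    measurable_withIntercept).exists_gram_lower_bound (ENNReal.half_pos hδ.ne')
  -- The `K + 1` cross moments, each at most `T ε'`, must contribute at most `(η T)(ε T)` to the
  -- squared norm.
  obtain ⟨ε', hε', hle⟩ : ∃ ε' > 0, (K + 1) * ε' ^ 2 ≤ ε * η := by
    refine ⟨√(ε * η / (K + 1)), by positivity, ?_⟩
    rw [Real.sq_sqrt (by positivity)]
    field_simp
    exact le_rfl
  have hsmall := ((hmeans a).withHighProb hε').and
    (WithHighProb.all fun k => hdep.withHighProb hwell hbase hK k a hε')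
  have hT : ∀ᶠ p : ℕ × ℕ in atTop ×ˢ atTop, T₁ ≤ p.2 ∧ 0 < p.2 :=
    tendsto_snd.eventually ((eventually_ge_atTop T₁).and (eventually_gt_atTop 0))
  filter_upwards [hT, ENNReal.tendsto_nhds_zero.1 hsmall _ (ENNReal.half_pos hδ.ne')]
    with p hp hbad
  obtain ⟨N, T⟩ := p
  simp only at hp hbad ⊢
  have hsub : {ω | ¬ ‖(M.regressorSpan T ω).starProjection (M.uvzPath N T ω a)‖ ^ 2 ≤ ε * T} ⊆
      {ω | ¬ (fun t => withIntercept (M.g t ω)) ∈ gramSet _ T (η * T)} ∪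
      {ω | ¬ (|(T : ℝ)⁻¹ * ∑ t ∈ Finset.range T, M.uvz N T t ω a| < ε' ∧
        ∀ k, |(T : ℝ)⁻¹ * ∑ t ∈ Finset.range T, M.g t ω k * M.uvz N T t ω a| < ε')} := by
    intro ω hω
    by_contra hcon
    simp only [Set.mem_union, Set.mem_ofPred_eq, not_or, not_not] at hcon
    refine hω ?_
    obtain ⟨hgram, hmean, hcross⟩ := hcon
    have hT0 : (0 : ℝ) < T := by exact_mod_cast hp.2
    have h1 := norm_starProjection_sq_le_of_mem_gramSet hgram (by positivity)
      (M.regressorSpan T ω) (fun z hz => FactorModel.exists_eq_inner_of_mem_regressorSpan hz)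
      (M.uvzPath N T ω a)
    have hsq : ∀ s : ℝ, |(T : ℝ)⁻¹ * s| < ε' → s ^ 2 ≤ T ^ 2 * ε' ^ 2 := by
      intro s hs
      rw [abs_mul, abs_of_pos (by positivity), inv_mul_lt_iff₀ hT0] at hs
      rw [← mul_pow, ← sq_abs]
      gcongr
    have h2 : ‖∑ t : Fin T, M.uvzPath N T ω a t • withIntercept (M.g t ω)‖ ^ 2 ≤
        T ^ 2 * ((K + 1) * ε' ^ 2) := by
      rw [EuclideanSpace.real_norm_sq_eq, Fintype.sum_option]
      have h3 : (∑ t : Fin T, M.uvzPath N T ω a t • withIntercept (M.g t ω)) none =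
          ∑ t ∈ Finset.range T, M.uvz N T t ω a := by
        rw [Finset.sum_range]
        simp [withIntercept, FactorModel.uvzPath]
      have h4 : ∀ k, (∑ t : Fin T, M.uvzPath N T ω a t • withIntercept (M.g t ω)) (some k) =
          ∑ t ∈ Finset.range T, M.g t ω k * M.uvz N T t ω a := by
        intro k
        rw [Finset.sum_range]
        simp [withIntercept, FactorModel.uvzPath, mul_comm]
      simp only [h3, h4]
      calc _ ≤ (T : ℝ) ^ 2 * ε' ^ 2 + ∑ _k : Fin K, (T : ℝ) ^ 2 * ε' ^ 2 :=
            add_le_add (hsq _ hmean) (Finset.sum_le_sum fun k _ => hsq _ (hcross k))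
        _ = T ^ 2 * ((K + 1) * ε' ^ 2) := by
            rw [Finset.sum_const, Finset.card_univ, Fintype.card_fin, nsmul_eq_mul]
            ring
    have h5 : η * T * ‖(M.regressorSpan T ω).starProjection (M.uvzPath N T ω a)‖ ^ 2 ≤
        η * T * (ε * T) := by
      refine (h1.trans h2).trans ?_
      calc (T : ℝ) ^ 2 * ((K + 1) * ε' ^ 2) ≤ T ^ 2 * (ε * η) := by gcongr
        _ = η * T * (ε * T) := by ring
    exact le_of_mul_le_mul_left h5 (by positivity)
  refine (measure_mono hsub).trans ((measure_union_le _ _).trans ?_)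
  exact (add_le_add (hT₁ T hp.1) hbad).trans_eq (ENNReal.add_halves δ)

end OmittedFactorProjection

end OmittedFactors

namespace OmittedFactors

/-! ### Strength of loadings and factors, and consistency of the estimator. -/

section Consistency

variable {Ω : Type*} {K Kz : ℕ} {M : FactorModel Ω K Kz} [MeasurableSpace Ω] {μ : Measure Ω}

theorem FactorModel.StrongLoadings.withHighProb (hload : M.StrongLoadings μ) :
    ∃ q > 0, WithHighProb μ fun N T ω => ∀ w : Fin K ⊕ Fin Kz → ℝ,
      N * q * ∑ a, w a ^ 2 ≤ ∑ i, (∑ a, M.cβγ N T ω i a * w a) ^ 2 := by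
  obtain ⟨-, Q, hQ, hlim⟩ := hload
  obtain ⟨q, hq, ε, hε, hle⟩ := exists_quadratic_form_lower_bound hQ
  refine ⟨q, hq, (WithHighProb.all fun a => WithHighProb.all fun b =>
    (hlim a b).withHighProb hε).mono ?_⟩
  have hpos : ∀ᶠ p : ℕ × ℕ in atTop ×ˢ atTop, 0 < p.1 :=
    tendsto_fst.eventually (eventually_gt_atTop 0)
  filter_upwards [hpos] with p hp ω hω w
  obtain ⟨N, T⟩ := p
  simp only at hp hω ⊢
  have hN : (0 : ℝ) < N := by exact_mod_cast hp
  have h := hle (Matrix.of fun a b =>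
    (N : ℝ)⁻¹ * ((M.cβγ N T ω).transpose * M.cβγ N T ω) a b) hω w
  have heq : ∑ i, (∑ a, M.cβγ N T ω i a * w a) ^ 2 = N * ∑ a, ∑ b, w a * w b *
      ((N : ℝ)⁻¹ * ((M.cβγ N T ω).transpose * M.cβγ N T ω) a b) := by
    simp only [sq, Finset.sum_mul_sum, Matrix.mul_apply, Matrix.transpose_apply]
    simp only [Finset.mul_sum]
    rw [Finset.sum_comm]
    refine Finset.sum_congr rfl fun a _ => ?_
    rw [Finset.sum_comm]
    refine Finset.sum_congr rfl fun b _ => Finset.sum_congr rfl fun i _ => ?_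
    field_simp
  rw [heq, mul_assoc]
  exact mul_le_mul_of_nonneg_left h hN.le

theorem FactorModel.OmittedFactorMoments.withHighProb (hmoments : M.OmittedFactorMoments μ) :
    ∃ s > 0, WithHighProb μ fun N T ω => ∀ b : Fin K ⊕ Fin Kz → ℝ,
      T * s * ∑ a, b a ^ 2 ≤ ‖∑ a, b a • M.uvzPath N T ω a‖ ^ 2 := by
  obtain ⟨S, hS, hlim⟩ := hmoments
  obtain ⟨s, hs, ε, hε, hle⟩ := exists_quadratic_form_lower_bound hS
  refine ⟨s, hs, (WithHighProb.all fun a => WithHighProb.all fun b =>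
    (hlim a b).withHighProb (tendsto_inv_sqrt_natCast.comp tendsto_snd) hε).mono ?_⟩
  have hpos : ∀ᶠ p : ℕ × ℕ in atTop ×ˢ atTop, 0 < p.2 :=
    tendsto_snd.eventually (eventually_gt_atTop 0)
  filter_upwards [hpos] with p hp ω hω w
  obtain ⟨N, T⟩ := p
  simp only at hp hω ⊢
  have hT : (0 : ℝ) < T := by exact_mod_cast hp
  have h := hle (Matrix.of fun a b =>
    (T : ℝ)⁻¹ * ∑ t ∈ Finset.range T, M.uvz N T t ω a * M.uvz N T t ω b) hω w
  have heq : ‖∑ a, w a • M.uvzPath N T ω a‖ ^ 2 = T * ∑ a, ∑ b, w a * w b *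
      ((T : ℝ)⁻¹ * ∑ t ∈ Finset.range T, M.uvz N T t ω a * M.uvz N T t ω b) := by
    rw [← real_inner_self_eq_norm_sq, sum_inner, Finset.mul_sum]
    refine Finset.sum_congr rfl fun a _ => ?_
    rw [inner_sum, Finset.mul_sum]
    refine Finset.sum_congr rfl fun b _ => ?_
    have hin : inner ℝ (M.uvzPath N T ω a) (M.uvzPath N T ω b) =
        ∑ t ∈ Finset.range T, M.uvz N T t ω a * M.uvz N T t ω b := by
      rw [Finset.sum_range]
      simp [FactorModel.uvzPath, PiLp.inner_apply, mul_comm]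
    rw [real_inner_smul_left, real_inner_smul_right, hin]
    field_simp
  rw [heq, mul_assoc]
  exact mul_le_mul_of_nonneg_left h hT.le

/-- The omitted factors remain strong after partialling out the regressors. -/
theorem FactorModel.exists_withHighProb_residual_factors [IsProbabilityMeasure μ]
    (hwell : M.WellPosed μ) (hbase : M.Baseline μ) (hK : 1 ≤ K) (hdep : M.WeakDependence μ)
    (hmoments : M.OmittedFactorMoments μ) (hmeans : M.OmittedFactorMeans μ) :
    ∃ s > 0, WithHighProb μ fun N T ω => ∀ b : Fin K ⊕ Fin Kz → ℝ,
      T * s * ∑ a, b a ^ 2 ≤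
        ‖(M.regressorSpan T ω)ᗮ.starProjection (∑ a, b a • M.uvzPath N T ω a)‖ ^ 2 := by
  obtain ⟨s, hs, hev⟩ := hmoments.withHighProb
  set d : ℝ := (Fintype.card (Fin K ⊕ Fin Kz) : ℝ) with hd
  have hd0 : 0 < d := by
    rw [hd, Fintype.card_sum, Fintype.card_fin, Fintype.card_fin]
    exact_mod_cast (by omega : 0 < K + Kz)
  -- Half of the strength `s` is given up to the projection, shared equally among the `d` factors.
  refine ⟨s / 2, by positivity, (hev.and (WithHighProb.all fun a =>
    M.withHighProb_projection_uvzPath hwell hbase hK hdep hmeans a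
      (by positivity : 0 < s / 2 / d))).mono (Eventually.of_forall fun p ω hω b => ?_)⟩
  obtain ⟨N, T⟩ := p
  obtain ⟨h1, h2⟩ := hω
  simp only at h1 h2 ⊢
  set P := (M.regressorSpan T ω).starProjection with hP
  set y := ∑ a, b a • M.uvzPath N T ω a with hy
  have hpyth : ‖y‖ ^ 2 = ‖P y‖ ^ 2 + ‖(M.regressorSpan T ω)ᗮ.starProjection y‖ ^ 2 :=
    Submodule.norm_sq_eq_add_norm_sq_starProjection y _
  have hPy : ‖P y‖ ^ 2 ≤ T * (s / 2) * ∑ a, b a ^ 2 := by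
    have hle : ‖P y‖ ≤ ∑ a, |b a| * ‖P (M.uvzPath N T ω a)‖ := by
      rw [hy, map_sum]
      refine (norm_sum_le _ _).trans_eq (Finset.sum_congr rfl fun a _ => ?_)
      rw [map_smul, norm_smul, Real.norm_eq_abs]
    calc ‖P y‖ ^ 2 ≤ (∑ a, |b a| * ‖P (M.uvzPath N T ω a)‖) ^ 2 := by gcongr
      _ ≤ (∑ a, |b a| ^ 2) * ∑ a, ‖P (M.uvzPath N T ω a)‖ ^ 2 :=
          Finset.sum_mul_sq_le_sq_mul_sq _ _ _
      _ ≤ (∑ a, |b a| ^ 2) * ∑ _a : Fin K ⊕ Fin Kz, s / 2 / d * T := by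
          gcongr with a
          exact h2 a
      _ = T * (s / 2) * ∑ a, b a ^ 2 := by
          simp only [sq_abs]
          rw [Finset.sum_const, Finset.card_univ, nsmul_eq_mul, ← hd]
          field_simp
  have := h1 b
  linarith

/-- With strong factors and weak noise, the penalized criterion is minimized exactly one above the
number of factors. -/
theorem FactorModel.IsFactorNumberEstimate.eq {φ : ℕ → ℕ → ℝ} {Kmax N T k : ℕ} {ω : Ω}
    (hK : 1 ≤ K) (hKmax : K + Kz < Kmax) (hN : 0 < N) (hT : K + Kz < T)
    (hk : M.IsFactorNumberEstimate μ φ Kmax N T ω k) (hφ : 0 < φ N T) {q s : ℝ}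
    (hq : 0 < q) (hs : 0 < s) (hφ_small : (K + Kz + 2) * φ N T < q * s / 2)
    (he : ∀ x, ∑ i, (inner ℝ (M.ePath N T ω i) x) ^ 2 ≤ N * T * (φ N T / 2) * ‖x‖ ^ 2)
    (hC : ∀ w : Fin K ⊕ Fin Kz → ℝ,
      N * q * ∑ a, w a ^ 2 ≤ ∑ i, (∑ a, M.cβγ N T ω i a * w a) ^ 2)
    (hU : ∀ b : Fin K ⊕ Fin Kz → ℝ, T * s * ∑ a, b a ^ 2 ≤
      ‖(M.regressorSpan T ω)ᗮ.starProjection (∑ a, b a • M.uvzPath N T ω a)‖ ^ 2) :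
    k = K + Kz := by
  have hcard : Fintype.card (Fin K ⊕ Fin Kz) = K + Kz := by simp
  have hN' : (0 : ℝ) < N := by exact_mod_cast hN
  have hT' : (0 : ℝ) < T := by exact_mod_cast (by omega : 0 < T)
  have hA := M.uhat_isHermitian μ N T ω
  have hup := eigDesc_residual_le (M.regressorSpan T ω) (M.uvzPath N T ω) (M.ePath N T ω)
    (M.cβγ N T ω) (M.uhat μ N T ω) (M.uhat_col μ N T ω) hA (by omega) he (by positivity)
  have hlow := le_eigDesc_residual (M.regressorSpan T ω) (M.uvzPath N T ω) (M.ePath N T ω)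
    (M.cβγ N T ω) (M.uhat μ N T ω) (M.uhat_col μ N T ω) hA (by omega) (by omega) he
    (by positivity) (by positivity) hC hU
  rw [hcard] at hup hlow
  obtain ⟨hmem, hmin⟩ := hk
  have hle := hmin (K + Kz + 1) (Finset.mem_Icc.2 ⟨by omega, hKmax⟩)
  simp only [FactorModel.criterion] at hle
  have hscale : ∀ x : ℝ, (N : ℝ)⁻¹ * (T : ℝ)⁻¹ * (N * T * x) = x := fun x => by field_simp
  have hinv : 0 ≤ (N : ℝ)⁻¹ * (T : ℝ)⁻¹ := by positivity
  have hup' := mul_le_mul_of_nonneg_left hup hinv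
  rw [hscale] at hup'
  push_cast at hle
  -- At index `K + Kz + 1` the criterion is at most `(K + Kz + 3/2) φ`. Too small an index gives at
  -- least `q s / 2 - φ / 2`, which is larger by `hφ_small`; too large an index gives at least `(K +
  -- Kz + 2) φ` from the penalty alone.
  rcases lt_trichotomy k (K + Kz) with hlt | heq | hgt
  · exfalso
    have hanti := eigDesc_antitone hA (j := k + 1) (k := K + Kz) (by omega) (by omega) hT.le
    have hlow' := mul_le_mul_of_nonneg_left (hlow.trans hanti) hinv
    have hsplit : (N : ℝ) * q * (T * s) / 2 - N * T * (φ N T / 2) =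
        N * T * (q * s / 2 - φ N T / 2) := by ring
    rw [hsplit, hscale] at hlow'
    have hk0 : 0 ≤ ((k : ℝ) + 1) * φ N T := by positivity
    linarith
  · exact heq
  · exfalso
    have hnonneg := mul_nonneg hinv (eigDesc_mul_transpose_nonneg (M.uhat μ N T ω) hA (k + 1))
    have hk1 : ((K : ℝ) + Kz + 1) * φ N T ≤ k * φ N T := by
      gcongr
      exact_mod_cast hgt
    linarith

end Consistency

end OmittedFactors

theorem mainTheorem11 {Ω : Type*} [MeasurableSpace Ω] (μ : Measure Ω) [IsProbabilityMeasure μ]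
    (K Kz : ℕ) (hK : 1 ≤ K) (M : OmittedFactors.FactorModel Ω K Kz)
    (hwell : M.WellPosed μ) (hbase : M.Baseline μ) (hload : M.StrongLoadings μ)
    (hnoise : M.WeakNoise μ) (hfourth : M.NoiseFourthMoments μ) (hdep : M.WeakDependence μ)
    (hloadnoise : M.LoadingsNoise μ) (hmoments : M.OmittedFactorMoments μ)
    (hmeans : M.OmittedFactorMeans μ)
    (φ : ℕ → ℕ → ℝ)
    (hφ : Tendsto (fun p : ℕ × ℕ => φ p.1 p.2) (atTop ×ˢ atTop) (𝓝 0))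
    (hφ_rate : Tendsto (fun p : ℕ × ℕ => φ p.1 p.2 / ((√(p.1 : ℝ))⁻¹ + (√(p.2 : ℝ))⁻¹))
      (atTop ×ˢ atTop) atTop)
    (Kmax : ℕ) (hKmax : K + Kz < Kmax)
    (Khat : ℕ → ℕ → Ω → ℕ)
    (hKhat : ∀ N T ω, M.IsFactorNumberEstimate μ φ Kmax N T ω (Khat N T ω)) :
    TendstoInMeasure μ (fun (p : ℕ × ℕ) ω => (Khat p.1 p.2 ω : ℝ)) (atTop ×ˢ atTop)
      (fun _ => ((K + Kz : ℕ) : ℝ)) := by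
  -- Positivity of the penalty is not assumed; the divergent ratio forces it eventually.
  have hφ_pos : ∀ᶠ p : ℕ × ℕ in atTop ×ˢ atTop, 0 < φ p.1 p.2 := by
    filter_upwards [hφ_rate.eventually_gt_atTop 0] with p hp
    by_contra hneg
    exact hp.not_ge (div_nonpos_of_nonpos_of_nonneg (not_lt.1 hneg) (by positivity))
  obtain ⟨q, hq, hC⟩ := hload.withHighProb
  obtain ⟨s, hs, hU⟩ :=
    M.exists_withHighProb_residual_factors hwell hbase hK hdep hmoments hmeans
  have hev : OmittedFactors.WithHighProb μ fun N T ω => Khat N T ω = K + Kz := by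
    refine ((hnoise.withHighProb hwell hφ_pos hφ_rate).and (hC.and hU)).mono ?_
    have hφ_small : ∀ᶠ p : ℕ × ℕ in atTop ×ˢ atTop,
        (K + Kz + 2) * φ p.1 p.2 < q * s / 2 := by
      have hlim := hφ.const_mul ((K : ℝ) + Kz + 2)
      rw [mul_zero] at hlim
      exact hlim.eventually_lt_const (by positivity)
    have hNT : ∀ᶠ p : ℕ × ℕ in atTop ×ˢ atTop, 0 < p.1 ∧ K + Kz < p.2 :=
      (eventually_gt_atTop 0).prod_mk (eventually_gt_atTop (K + Kz))
    filter_upwards [hφ_pos, hφ_small, hNT] with p h1 h2 h3 ω ⟨h4, h5, h6⟩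
    exact (hKhat p.1 p.2 ω).eq hK hKmax h3.1 h3.2 h1 hq hs h2 h4 h5 h6
  intro ε hε
  -- The estimator equals the true number with probability tending to one. Only monotonicity of `μ`
  -- is applied here, so an arbitrary, possibly nonmeasurable, rule for ties is allowed.
  refine tendsto_of_tendsto_of_tendsto_of_le_of_le tendsto_const_nhds hev
    (fun _ => zero_le) fun p => measure_mono fun ω hω heq => ?_
  have hω' : ε ≤ edist (Khat p.1 p.2 ω : ℝ) ((K + Kz : ℕ) : ℝ) := hω
  rw [heq, edist_self] at hω'
  exact hε.not_ge hω'
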